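/- Let $X$ be a real-valued random variable with a log-concave density $p$, i.e. $p(x)=e^{-\Phi(x)}$ for all $x\in\mathbb R$, where $\Phi:\mathbb R\to\mathbb R\cup\{+\infty\}$ is convex and lower semicontinuous, and let $h(X)=-\int p\log p$ be its differential entropy. For $\varepsilon>0$ and $n\ge 1$ let $$\mathcal T_n^\varepsilon=\Big\{x\in\mathbb R^n : \prod_{i=1}^n p(x_i)\ge e^{-n(h(X)+\varepsilon)}\Big\}$$ be the one-sided $\varepsilon$-typical set, and let $\mu_n^\varepsilon(j)=V_j(\mathcal T_n^\varepsilon)$, $0\le j\le n$, be its intrinsic volumes, i.e. the coefficients in Steiner's formula $|\mathcal T_n^\varepsilon\oplus tB_n|=\sum_{j=0}^n V_{n-j}(\mathcal T_n^\varepsilon)\,\omega_j t^j$ for $t\ge 0$, where $B_n$ is the closed Euclidean unit ball of $\mathbb R^n$ and $\omega_j$ is the volume of the unit ball of $\mathbb R^j$. For $t\in\mathbb R$ put $$\Lambda^\varepsilon(t)=\lim_{n\to\infty}\frac1n\log\sum_{j=0}^n\mu_n^\varepsilon(j)e^{jt},\qquad (\Lambda^\varepsilon)^*(\theta)=\sup_{t\in\mathbb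 R}\big(\theta t-\Lambda^\varepsilon(t)\big).$$ Then for every $\varepsilon>0$ the limit $\Lambda^\varepsilon(t)$ exists and is finite for every $t\in\mathbb R$, and $(\Lambda^\varepsilon)^*(\theta)$ is finite for every $\theta\in[0,1]$. Moreover, for every $\theta\in[0,1]$ the limit $$-\Lambda^*(\theta):=\lim_{\varepsilon\to0+}-(\Lambda^\varepsilon)^*(\theta)$$ exists in $\mathbb R$, and $-\Lambda^*$ is a continuous, concave function on $[0,1]$. -/

import Mathlib

open MeasureTheory Filter Topology
open scoped Pointwise

/-- Volume `ω_j` of the unit ball of `ℝ^j` (with `ω_0 = 1`). -/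
noncomputable def unitBallVolume (j : ℕ) : ℝ :=
  (volume (Metric.closedBall (0 : EuclideanSpace ℝ (Fin j)) 1)).toReal

/-- `V 0, …, V n` are the coefficients in Steiner's formula for `K ⊆ ℝ^n`:
`|K ⊕ t B_n| = ∑_{j=0}^n V_{n-j} ω_j t^j` for all `t ≥ 0`; by convention `V j = 0` for `j > n`. -/
def IsSteinerCoefficients {n : ℕ} (K : Set (EuclideanSpace ℝ (Fin n))) (V : ℕ → ℝ) : Prop :=
  (∀ j, n < j → V j = 0) ∧
  ∀ t : ℝ, 0 ≤ t →
    (volume (K + Metric.closedBall (0 : EuclideanSpace ℝ (Fin n)) t)).toReal =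
      ∑ j ∈ Finset.range (n + 1), V (n - j) * unitBallVolume j * t ^ j

lemma unitBallVolume_pos (j : ℕ) : 0 < unitBallVolume j := by
  unfold unitBallVolume
  refine ENNReal.toReal_pos ?_ ?_
  · exact (Metric.measure_closedBall_pos volume _ one_pos).ne'
  · exact (isCompact_closedBall _ _).measure_lt_top.ne

/-- The Steiner coefficients of a set are unique. -/
lemma IsSteinerCoefficients.unique {n : ℕ} {K : Set (EuclideanSpace ℝ (Fin n))} {V W : ℕ → ℝ}
    (hV : IsSteinerCoefficients K V) (hW : IsSteinerCoefficients K W) : V = W := by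
  have key : (∑ j ∈ Finset.range (n + 1),
      Polynomial.monomial j (V (n - j) * unitBallVolume j) : Polynomial ℝ) =
      ∑ j ∈ Finset.range (n + 1), Polynomial.monomial j (W (n - j) * unitBallVolume j) := by
    refine Polynomial.eq_of_infinite_eval_eq _ _ ((Set.Ici_infinite (0 : ℝ)).mono ?_)
    intro t ht
    have h1 := hV.2 t ht
    have h2 := hW.2 t ht
    simp only [Set.mem_ofPred_eq, Polynomial.eval_finsetSum, Polynomial.eval_monomial]
    rw [← h1, ← h2]
  funext i
  by_cases hi : n < i
  · rw [hV.1 i hi, hW.1 i hi]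
  · have h := congrArg (fun q => Polynomial.coeff q (n - i)) key
    have hmem : n - i < n + 1 := by omega
    have hsub : n - (n - i) = i := by omega
    simp only [Polynomial.finsetSum_coeff, Polynomial.coeff_monomial, Finset.sum_ite_eq',
      Finset.mem_range, hmem, if_true, hsub] at h
    exact mul_right_cancel₀ (unitBallVolume_pos _).ne' h

open Classical in
/-- The `j`-th intrinsic volume `V_j(K)` of `K ⊆ ℝ^n`: the coefficient in Steiner's formula.
(Compact convex sets satisfy Steiner's formula; sets without such a formula get the value `0`.) -/
noncomputable def intrinsicVolume {n : ℕ} (K : Set (EuclideanSpace ℝ (Fin n))) (j : ℕ) : ℝ :=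
  if h : ∃ V : ℕ → ℝ, IsSteinerCoefficients K V then h.choose j else 0

lemma IsSteinerCoefficients.intrinsicVolume_eq {n : ℕ} {K : Set (EuclideanSpace ℝ (Fin n))}
    {V : ℕ → ℝ} (hV : IsSteinerCoefficients K V) (j : ℕ) : intrinsicVolume K j = V j := by
  have h : ∃ V : ℕ → ℝ, IsSteinerCoefficients K V := ⟨V, hV⟩
  rw [intrinsicVolume, dif_pos h, h.choose_spec.unique hV]

/-- `p = e^{-Φ}` everywhere on `ℝ`, for some lower semicontinuous convex
`Φ : ℝ → ℝ ∪ {+∞}` (with `e^{-∞} = 0`). -/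
def IsLogConcave (p : ℝ → ℝ) : Prop :=
  ∃ Φ : ℝ → EReal,
    (∀ x, Φ x ≠ ⊥) ∧
    LowerSemicontinuous Φ ∧
    (∀ x y a b : ℝ, 0 < a → 0 < b → a + b = 1 →
      Φ (a * x + b * y) ≤ (a : EReal) * Φ x + (b : EReal) * Φ y) ∧
    ∀ x, p x = (EReal.exp (-Φ x)).toReal

/-- Differential entropy `h = -∫ p log p` of a density `p` (with `0 log 0 = 0`). -/
noncomputable def differentialEntropy (p : ℝ → ℝ) : ℝ :=
  -∫ x, p x * Real.log (p x)

/-- The one-sided `ε`-typical set `T_n^ε = {x ∈ ℝ^n | ∏ p(x_i) ≥ e^{-n(h+ε)}}`. -/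
def typicalSet (p : ℝ → ℝ) (ε : ℝ) (n : ℕ) : Set (EuclideanSpace ℝ (Fin n)) :=
  {x | Real.exp (-(n * (differentialEntropy p + ε))) ≤ ∏ i, p (x i)}

/-- `G_n^ε(t) = log ∑_{j=0}^n μ_n^ε(j) e^{jt}`, where `μ_n^ε(j) = V_j(T_n^ε)`. -/
noncomputable def logGenFun (p : ℝ → ℝ) (ε : ℝ) (n : ℕ) (t : ℝ) : ℝ :=
  Real.log (∑ j ∈ Finset.range (n + 1), intrinsicVolume (typicalSet p ε n) j * Real.exp (j * t))

/-- `Λ^ε(t) = lim_{n → ∞} G_n^ε(t) / n`. -/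
noncomputable def limitLogGenFun (p : ℝ → ℝ) (ε : ℝ) (t : ℝ) : ℝ :=
  limUnder atTop (fun n : ℕ => logGenFun p ε n t / n)

/-- Convex conjugate `g^*(θ) = sup_t (θ t - g(t))`, at those `θ` where the supremum is finite. -/
noncomputable def convexConjugate (g : ℝ → ℝ) (θ : ℝ) : ℝ :=
  ⨆ t : ℝ, (θ * t - g t)

/-- The candidate function `-Λ^*(θ) = lim_{ε → 0+} -(Λ^ε)^*(θ)`. -/
noncomputable def candidateFun (p : ℝ → ℝ) (θ : ℝ) : ℝ :=
  limUnder (𝓝[>] (0 : ℝ)) (fun ε : ℝ => -convexConjugate (limitLogGenFun p ε) θ)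

/-! For a convex body `K` in dimension `n`, the sum of `V_j(K) e^{jt}` equals the Wills functional
`e^{nt} ∫ exp(-π e^{2t} d(x,K)²) dx` (`sum_intrinsicVolume_mul_exp`). To see this, slice the
integral by the parallel sets of `K`, whose volumes are given by Steiner's formula; each term `ω_j
r^j` then contributes a `j`-dimensional Gaussian integral. Steiner's formula is itself proved by
rescaling along normals, a map whose Jacobian is polynomial in the scale.

In this integral form the functional is visibly monotone in `K`, and it is supermultiplicative
because squared distances add over orthogonal factors (`willsFunctional_mul_le`). Log-concavity
makes the typical sets convex bodies, and `T_m × T_n ⊆ T_{m+n}`, so Fekete's lemma yields `Λ^ε(t)`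
as a supremum over `n ≥ 1`. It is finite because a log-concave density decays exponentially: `T_n`
lies in a cross-polytope of size linear in `n`, where the functional grows at most exponentially
(`exists_willsFunctional_le_pow`).

Two lower bounds hold uniformly in `ε`: `Λ^ε(t) ≥ 0`, since `T_n` contains a point, and `Λ^ε(t) ≥ t
+ l`, where `l` is the log-volume of the one-dimensional set at `ε = 0`. They bound the conjugates
on `[0,1]`, and monotonicity in `ε` gives the limit. The limit is concave, hence lower
semicontinuous on `[0,1]`; it is also an infimum over `ε` and `t` of the affine functions `Λ^ε(t) -
θt`, hence upper semicontinuous. -/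

/-! ### Metric projection onto a convex set and rescaling along its normals. -/

section MetricProjection

variable {E : Type*} [NormedAddCommGroup E] [InnerProductSpace ℝ E] {K : Set E} {q : E → E}

/-- `q` is the metric projection onto the convex set `K`, in its variational characterization. -/
structure IsMetricProjection (K : Set E) (q : E → E) : Prop where
  mem : ∀ x, q x ∈ K
  inner_le : ∀ x, ∀ w ∈ K, inner ℝ (x - q x) (w - q x) ≤ 0

lemma exists_isMetricProjection (hne : K.Nonempty) (hc : IsComplete K) (hconv : Convex ℝ K) :
    ∃ q, IsMetricProjection K q := by
  choose q hq using fun u => exists_norm_eq_iInf_of_complete_convex hne hc hconv u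
  exact ⟨q, fun x => (hq x).1,
    fun x => (norm_eq_iInf_iff_real_inner_le_zero hconv (hq x).1).1 (hq x).2⟩

namespace IsMetricProjection

/-- Firm nonexpansiveness: add the variational inequalities at `x` and `y`, each tested against the
other projection. It gives the Lipschitz bound and, infinitesimally, the positivity of the Jacobian.
-/
lemma norm_sq_le_inner (hq : IsMetricProjection K q) (x y : E) :
    ‖q x - q y‖ ^ 2 ≤ inner ℝ (q x - q y) (x - y) := by
  have h1 := hq.inner_le x (q y) (hq.mem y)
  have h2 := hq.inner_le y (q x) (hq.mem x)
  rw [← real_inner_self_eq_norm_sq]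
  simp only [inner_sub_left, inner_sub_right] at *
  have := real_inner_comm x (q x)
  have := real_inner_comm x (q y)
  have := real_inner_comm y (q x)
  have := real_inner_comm y (q y)
  have := real_inner_comm (q x) (q y)
  linarith

lemma lipschitzWith (hq : IsMetricProjection K q) : LipschitzWith 1 q := by
  refine LipschitzWith.of_dist_le_mul fun x y => ?_
  rw [NNReal.coe_one, one_mul, dist_eq_norm, dist_eq_norm]
  have h := (hq.norm_sq_le_inner x y).trans (real_inner_le_norm _ _)
  by_contra hlt
  push Not at hlt
  nlinarith [norm_nonneg (x - y), norm_nonneg (q x - q y)]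

lemma eq_of_inner_le (hq : IsMetricProjection K q) {x v : E} (hv : v ∈ K)
    (h : ∀ w ∈ K, inner ℝ (x - v) (w - v) ≤ 0) : q x = v := by
  have h1 := hq.inner_le x v hv
  have h2 := h (q x) (hq.mem x)
  have h3 : inner ℝ (q x - v) (q x - v) ≤ 0 := by
    simp only [inner_sub_left, inner_sub_right] at *
    have := real_inner_comm v (q x)
    linarith
  exact sub_eq_zero.1 (real_inner_self_nonpos.1 h3)

lemma infDist_eq (hq : IsMetricProjection K q) (x : E) : Metric.infDist x K = ‖x - q x‖ := by
  refine le_antisymm ((Metric.infDist_le_dist_of_mem (hq.mem x)).trans_eq (dist_eq_norm _ _)) ?_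
  refine (Metric.le_infDist ⟨_, hq.mem x⟩).2 fun w hw => ?_
  have h1 := hq.inner_le x w hw
  have h2 : ‖x - w‖ ^ 2 = ‖x - q x‖ ^ 2 - 2 * inner ℝ (x - q x) (w - q x) + ‖w - q x‖ ^ 2 := by
    rw [← norm_sub_sq_real]; congr 2; abel
  rw [dist_eq_norm]
  refine (pow_le_pow_iff_left₀ (norm_nonneg _) (norm_nonneg _) two_ne_zero).1 ?_
  nlinarith [sq_nonneg ‖w - q x‖]

/-- Scaling by `s` along the normals of `K`. -/
lemma apply_normalScaling (hq : IsMetricProjection K q) {s : ℝ} (hs : 0 ≤ s) (x : E) :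
    q (q x + s • (x - q x)) = q x := by
  refine hq.eq_of_inner_le (hq.mem x) fun w hw => ?_
  rw [add_sub_cancel_left, real_inner_smul_left]
  exact mul_nonpos_of_nonneg_of_nonpos hs (hq.inner_le x w hw)

lemma infDist_normalScaling (hq : IsMetricProjection K q) {s : ℝ} (hs : 0 ≤ s) (x : E) :
    Metric.infDist (q x + s • (x - q x)) K = s * Metric.infDist x K := by
  rw [hq.infDist_eq, hq.infDist_eq, hq.apply_normalScaling hs, add_sub_cancel_left, norm_smul,
    Real.norm_of_nonneg hs]

lemma normalScaling_inv (hq : IsMetricProjection K q) {s r : ℝ} (hs : 0 ≤ s) (hr : r * s = 1)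
    (x : E) :
    q (q x + s • (x - q x)) + r • (q x + s • (x - q x) - q (q x + s • (x - q x))) = x := by
  rw [hq.apply_normalScaling hs, add_sub_cancel_left, smul_smul, hr, one_smul, add_sub_cancel]

lemma injective_normalScaling (hq : IsMetricProjection K q) {s : ℝ} (hs : 0 < s) :
    Function.Injective fun x => q x + s • (x - q x) :=
  Function.LeftInverse.injective (g := fun x => q x + s⁻¹ • (x - q x)) fun x =>
    hq.normalScaling_inv hs.le (inv_mul_cancel₀ hs.ne') x

lemma image_normalScaling (hq : IsMetricProjection K q) {s : ℝ} (hs : 0 < s) :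
    (fun x => q x + s • (x - q x)) '' {x | Metric.infDist x K ≤ 1} =
      {x | Metric.infDist x K ≤ s} := by
  ext y
  constructor
  · rintro ⟨x, hx, rfl⟩
    rw [Set.mem_ofPred_eq] at hx ⊢
    rw [hq.infDist_normalScaling hs.le]
    nlinarith
  · intro hy
    refine ⟨q y + s⁻¹ • (y - q y), ?_, hq.normalScaling_inv (inv_nonneg.2 hs.le)
      (mul_inv_cancel₀ hs.ne') y⟩
    rw [Set.mem_ofPred_eq] at hy ⊢
    rw [hq.infDist_normalScaling (inv_nonneg.2 hs.le), inv_mul_le_iff₀ hs, mul_one]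
    exact hy

/-- Firm nonexpansiveness survives the limit of difference quotients. -/
lemma norm_sq_fderiv_le_inner (hq : IsMetricProjection K q) {x : E} (hx : DifferentiableAt ℝ q x)
    (v : E) : ‖fderiv ℝ q x v‖ ^ 2 ≤ inner ℝ (fderiv ℝ q x v) v := by
  have h1 : Tendsto (fun t : ℝ => t⁻¹ • (q (x + t • v) - q x)) (𝓝[≠] 0) (𝓝 (fderiv ℝ q x v)) := by
    have := (hx.hasFDerivAt.hasLineDerivAt v)
    exact this.tendsto_slope_zero
  have h2 : Tendsto (fun t : ℝ => ‖t⁻¹ • (q (x + t • v) - q x)‖ ^ 2) (𝓝[≠] 0)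
    (𝓝 (‖fderiv ℝ q x v‖ ^ 2)) := h1.norm.pow 2
  have h3 : Tendsto (fun t : ℝ => inner ℝ (t⁻¹ • (q (x + t • v) - q x)) v) (𝓝[≠] 0)
    (𝓝 (inner ℝ (fderiv ℝ q x v) v)) := h1.inner tendsto_const_nhds
  refine le_of_tendsto_of_tendsto h2 h3 ?_
  filter_upwards [self_mem_nhdsWithin] with t ht
  have ht : t ≠ 0 := ht
  have h := hq.norm_sq_le_inner (x + t • v) x
  rw [add_sub_cancel_left, real_inner_smul_right] at h
  rw [norm_smul, mul_pow, real_inner_smul_left, Real.norm_eq_abs, sq_abs]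
  calc t⁻¹ ^ 2 * ‖q (x + t • v) - q x‖ ^ 2
      ≤ t⁻¹ ^ 2 * (t * inner ℝ (q (x + t • v) - q x) v) := by gcongr
    _ = _ := by field_simp

end IsMetricProjection

/-- The determinant of `P + s (1 - P)` is a polynomial in `s`. -/
lemma exists_polynomial_det_add_smul [FiniteDimensional ℝ E] (P : E →L[ℝ] E) :
    ∃ Q : Polynomial ℝ, Q.natDegree ≤ Module.finrank ℝ E ∧
      ∀ s : ℝ, (P + s • (ContinuousLinearMap.id ℝ E - P)).det = Q.eval s := by
  let b := Module.finBasis ℝ E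
  let M := LinearMap.toMatrix b b (P : E →ₗ[ℝ] E)
  refine ⟨((Polynomial.X : Polynomial ℝ) • (1 - M).map Polynomial.C + M.map Polynomial.C).det,
    (Polynomial.natDegree_det_X_add_C_le _ _).trans_eq (Fintype.card_fin _), fun s => ?_⟩
  rw [ContinuousLinearMap.det, ← LinearMap.det_toMatrix b, ← Polynomial.coe_evalRingHom,
    RingHom.map_det]
  congr 1
  have : ((P + s • (ContinuousLinearMap.id ℝ E - P) : E →L[ℝ] E) : E →ₗ[ℝ] E) =
      (P : E →ₗ[ℝ] E) + s • (LinearMap.id - (P : E →ₗ[ℝ] E)) := rfl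
  rw [this, map_add, map_smul, map_sub, LinearMap.toMatrix_id]
  ext i j
  simp [M]
  ring

/-- A kernel vector would have `P v` a negative multiple of `v - P v`, while the hypothesis makes
their inner product nonnegative, so `v = 0`. The determinant thus never vanishes for positive
scales; it is `1` at scale `1`, and the intermediate value theorem fixes its sign. -/
lemma det_add_smul_pos [FiniteDimensional ℝ E] {P : E →L[ℝ] E}
    (hP : ∀ v, ‖P v‖ ^ 2 ≤ inner ℝ (P v) v) {s : ℝ} (hs : 0 < s) :
    0 < (P + s • (ContinuousLinearMap.id ℝ E - P)).det := by
  have hne : ∀ r : ℝ, 0 < r → (P + r • (ContinuousLinearMap.id ℝ E - P)).det ≠ 0 := by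
    intro r hr h0
    have := LinearMap.bot_lt_ker_of_det_eq_zero h0
    obtain ⟨v, hv, hv0⟩ := Submodule.exists_mem_ne_zero_of_ne_bot this.ne'
    apply hv0
    have hv' : P v + r • (v - P v) = 0 := by simpa using hv
    have h1 : P v = -(r • (v - P v)) := eq_neg_of_add_eq_zero_left hv'
    have h2 : 0 ≤ inner ℝ (P v) (v - P v) := by
      rw [inner_sub_right, real_inner_self_eq_norm_sq]; linarith [hP v]
    have h3 : v - P v = 0 := by
      rw [h1, inner_neg_left, real_inner_smul_left] at h2
      rw [← h1] at h2
      refine real_inner_self_nonpos.1 ?_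
      by_contra! hlt
      have : 0 < r * inner ℝ (v - P v) (v - P v) := mul_pos hr hlt
      linarith
    rw [h3, smul_zero, neg_zero] at h1
    rwa [h1, sub_zero] at h3
  obtain ⟨Q, -, hQ⟩ := exists_polynomial_det_add_smul P
  by_contra! hle
  have h1 : Q.eval 1 = 1 := by
    rw [← hQ 1, one_smul, add_sub_cancel]
    exact LinearMap.det_id
  have := intermediate_value_uIcc (a := s) (b := 1) (f := fun r => Q.eval r)
    Q.continuous.continuousOn
  obtain ⟨r, hr, hr0⟩ := this (Set.mem_uIcc_of_le (a := Q.eval s) (x := 0) (b := Q.eval 1)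
    (by rwa [← hQ s]) (by rw [h1]; norm_num))
  have hr' : 0 < r := (lt_min hs one_pos).trans_le hr.1
  exact hne r hr' ((hQ r).trans hr0)

end MetricProjection

/-! ### Steiner's formula for convex bodies. -/

section Steiner

variable {E : Type*} [NormedAddCommGroup E] [InnerProductSpace ℝ E] [FiniteDimensional ℝ E]
  [MeasurableSpace E] [BorelSpace E] {K : Set E} {q : E → E}

/-- Lebesgue measure and top-dimensional Hausdorff measure have the same null sets, and Lipschitz
maps control the latter. -/
lemma volume_image_eq_zero_of_lipschitzWith {C : NNReal} {f : E → E} (hf : LipschitzWith C f)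
    {s : Set E} (hs : volume s = 0) : volume (f '' s) = 0 := by
  have h1 : (volume : Measure E) ≪ μH[(Module.finrank ℝ E : ℝ)] :=
    Measure.absolutelyContinuous_isAddHaarMeasure _ _
  have h2 : μH[(Module.finrank ℝ E : ℝ)] ≪ (volume : Measure E) :=
    Measure.absolutelyContinuous_isAddHaarMeasure _ _
  refine h1 (le_antisymm ?_ bot_le)
  calc _ ≤ _ := hf.hausdorffMeasure_image_le (Nat.cast_nonneg _) s
    _ = 0 := by rw [h2 hs, mul_zero]

lemma setOf_infDist_le_eq_cthickening {E : Type*} [PseudoMetricSpace E] {K : Set E}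
    (hne : K.Nonempty) {t : ℝ} (ht : 0 ≤ t) :
    {x | Metric.infDist x K ≤ t} = Metric.cthickening t K := by
  ext x
  rw [Set.mem_ofPred_eq, Metric.mem_cthickening_iff, Metric.infDist,
    ENNReal.le_ofReal_iff_toReal_le (Metric.infEDist_ne_top hne) ht]

lemma volume_setOf_infDist_le_lt_top (hK : IsCompact K) (hne : K.Nonempty) (t : ℝ) :
    volume {x | Metric.infDist x K ≤ t} < ⊤ := by
  refine (measure_mono (t := {x | Metric.infDist x K ≤ max t 0})
    fun x (hx : Metric.infDist x K ≤ t) => le_max_of_le_left hx).trans_lt ?_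
  rw [setOf_infDist_le_eq_cthickening hne (le_max_right _ _)]
  exact hK.cthickening.measure_lt_top

/-- Change of variables along the normals of `K`. -/
lemma IsMetricProjection.lintegral_det_eq_volume (hq : IsMetricProjection K q) {s : ℝ}
    (hs : 0 < s) :
    ∫⁻ x in {x | Metric.infDist x K ≤ 1} ∩ {x | DifferentiableAt ℝ q x},
      ENNReal.ofReal (fderiv ℝ q x + s • (ContinuousLinearMap.id ℝ E - fderiv ℝ q x)).det =
      volume {x | Metric.infDist x K ≤ s} := by
  set A := {x | Metric.infDist x K ≤ 1}
  set D := {x | DifferentiableAt ℝ q x}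
  set F : E → E := fun x => q x + s • (x - q x)
  have hA : MeasurableSet A := measurableSet_le (Metric.continuous_infDist_pt K).measurable
    measurable_const
  have hD : MeasurableSet D := measurableSet_of_differentiableAt ℝ q
  have h1 := lintegral_abs_det_fderiv_eq_addHaar_image (s := A ∩ D) (f := F)
    (f' := fun x => fderiv ℝ q x + s • (ContinuousLinearMap.id ℝ E - fderiv ℝ q x)) volume
    (hA.inter hD)
    (fun x hx => (hx.2.hasFDerivAt.add
      (((hasFDerivAt_id x).sub hx.2.hasFDerivAt).const_smul s)).hasFDerivWithinAt)
    (hq.injective_normalScaling hs).injOn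
  have hLip : ∃ C, LipschitzWith C F :=
    ⟨_, hq.lipschitzWith.add ((lipschitzWith_smul s).comp
      (LipschitzWith.id.sub hq.lipschitzWith))⟩
  obtain ⟨C, hC⟩ := hLip
  -- Rademacher's theorem: the points where the change of variables does not apply form a null set,
  -- and so does their image.
  have hDc : volume Dᶜ = 0 := hq.lipschitzWith.ae_differentiableAt (μ := volume)
  have h2 : volume (F '' (A ∩ Dᶜ)) = 0 := volume_image_eq_zero_of_lipschitzWith hC
    (measure_mono_null Set.inter_subset_right hDc)
  have h3 : volume (F '' (A ∩ D)) = volume {x | Metric.infDist x K ≤ s} := by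
    rw [← hq.image_normalScaling hs]
    refine le_antisymm (measure_mono (Set.image_mono Set.inter_subset_left)) ?_
    calc volume (F '' A) ≤ volume (F '' (A ∩ D) ∪ F '' (A ∩ Dᶜ)) := by
          rw [← Set.image_union, Set.inter_union_compl]
      _ ≤ _ := measure_union_le _ _
      _ = _ := by rw [h2, add_zero]
  rw [← h3, ← h1]
  refine setLIntegral_congr_fun (hA.inter hD) fun x hx => ?_
  rw [abs_of_pos]
  exact det_add_smul_pos (hq.norm_sq_fderiv_le_inner hx.2) hs

/-- Steiner's formula: the volume of the parallel sets of a convex body is a polynomial. -/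
theorem exists_polynomial_volume_infDist_le (hK : IsCompact K) (hne : K.Nonempty)
    (hconv : Convex ℝ K) :
    ∃ Q : Polynomial ℝ, Q.natDegree ≤ Module.finrank ℝ E ∧
      ∀ t : ℝ, 0 ≤ t → (volume {x | Metric.infDist x K ≤ t}).toReal = Q.eval t := by
  obtain ⟨q, hq⟩ := exists_isMetricProjection hne hK.isComplete hconv
  set S : Set E := {x | Metric.infDist x K ≤ 1} ∩ {x | DifferentiableAt ℝ q x}
  have hS : MeasurableSet S := (measurableSet_le (Metric.continuous_infDist_pt K).measurable
    measurable_const).inter (measurableSet_of_differentiableAt ℝ q)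
  let d : ℝ → E → ℝ := fun s x =>
    (fderiv ℝ q x + s • (ContinuousLinearMap.id ℝ E - fderiv ℝ q x)).det
  have hdm : ∀ s, Measurable (d s) := fun s =>
    (ContinuousLinearMap.continuous_det.comp (f := fun P : E →L[ℝ] E =>
      P + s • (ContinuousLinearMap.id ℝ E - P)) (by fun_prop)).measurable.comp
      (measurable_fderiv ℝ q)
  have hpos : ∀ s, 0 < s → 0 ≤ᵐ[volume.restrict S] d s := fun s hs =>
    (ae_restrict_mem hS).mono fun x hx => (det_add_smul_pos (hq.norm_sq_fderiv_le_inner hx.2) hs).le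
  have hlint : ∀ s, 0 < s → ∫⁻ x in S, ENNReal.ofReal (d s x) =
      volume {x | Metric.infDist x K ≤ s} := fun s hs => hq.lintegral_det_eq_volume hs
  have hint : ∀ s, 0 < s → IntegrableOn (d s) S := fun s hs => by
    refine ⟨(hdm s).aestronglyMeasurable, ?_⟩
    rw [hasFiniteIntegral_iff_ofReal (hpos s hs), hlint s hs]
    exact volume_setOf_infDist_le_lt_top hK hne s
  have hval : ∀ s, 0 < s → ∫ x in S, d s x = (volume {x | Metric.infDist x K ≤ s}).toReal :=
    fun s hs => by
      rw [integral_eq_lintegral_of_nonneg_ae (hpos s hs) (hdm s).aestronglyMeasurable, hlint s hs]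
  let N := Module.finrank ℝ E
  -- Interpolating at the nodes `1, …, N + 1` writes the Jacobian at scale `t` as a fixed
  -- combination of Jacobians at the nodes, which are already known to be integrable. The nodes
  -- avoid `0`, where the rescaling is not injective in general.
  let v : ℕ → ℝ := fun i => i + 1
  have hv : Set.InjOn v (Finset.range (N + 1)) := fun i _ j _ h => by simpa [v] using h
  have hvpos : ∀ i, 0 < v i := fun i => by positivity
  refine ⟨Lagrange.interpolate (Finset.range (N + 1)) v
    fun i => (volume {x | Metric.infDist x K ≤ v i}).toReal, ?_, ?_⟩
  · have := Lagrange.degree_interpolate_lt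
      (fun i => (volume {x | Metric.infDist x K ≤ v i}).toReal) hv
    rw [Finset.card_range] at this
    exact Polynomial.natDegree_le_of_degree_le (Order.lt_succ_iff.1 this)
  set Q := Lagrange.interpolate (Finset.range (N + 1)) v
    fun i => (volume {x | Metric.infDist x K ≤ v i}).toReal
  have hQpos : ∀ t : ℝ, 0 < t → (volume {x | Metric.infDist x K ≤ t}).toReal = Q.eval t := by
    intro t ht
    have hd : ∀ x, d t x = ∑ i ∈ Finset.range (N + 1),
        d (v i) x * (Lagrange.basis (Finset.range (N + 1)) v i).eval t := by
      intro x
      obtain ⟨R, hR, hRd⟩ := exists_polynomial_det_add_smul (fderiv ℝ q x)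
      have hRdeg : R.degree < (Finset.range (N + 1)).card := by
        rw [Finset.card_range]
        exact (Polynomial.degree_le_of_natDegree_le hR).trans_lt
          (WithBot.coe_lt_coe.2 (Nat.cast_lt.2 (Nat.lt_succ_self _)))
      have h := congrArg (Polynomial.eval t) (Lagrange.eq_interpolate hv hRdeg)
      rw [Lagrange.interpolate_apply, Polynomial.eval_finsetSum] at h
      simp only [Polynomial.eval_mul, Polynomial.eval_C, ← hRd] at h
      exact h
    rw [← hval t ht]
    simp_rw [hd]
    rw [integral_finsetSum _ fun i _ => (hint _ (hvpos i)).mul_const _]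
    simp_rw [integral_mul_const, hval _ (hvpos _)]
    simp only [Q, Lagrange.interpolate_apply, Polynomial.eval_finsetSum, Polynomial.eval_mul,
      Polynomial.eval_C]
  intro t ht
  rcases ht.eq_or_lt with rfl | ht
  -- At `t = 0` the formula follows by continuity from the right.
  · have h1 : Tendsto (fun r => (volume (Metric.cthickening r K)).toReal) (𝓝[>] 0)
        (𝓝 (volume K).toReal) :=
      ((ENNReal.tendsto_toReal hK.measure_lt_top.ne).comp
        (tendsto_measure_cthickening_of_isCompact hK)).mono_left nhdsWithin_le_nhds
    have h2 : Tendsto (fun r => Q.eval r) (𝓝[>] 0) (𝓝 (Q.eval 0)) :=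
      (Q.continuous.tendsto 0).mono_left nhdsWithin_le_nhds
    rw [setOf_infDist_le_eq_cthickening hne le_rfl, Metric.cthickening_zero,
      hK.isClosed.closure_eq]
    refine tendsto_nhds_unique (h1.congr' ?_) h2
    filter_upwards [self_mem_nhdsWithin] with r hr
    rw [← setOf_infDist_le_eq_cthickening hne (le_of_lt hr), hQpos r hr]
  · exact hQpos t ht

end Steiner

/-- A convex body has Steiner coefficients, given by its intrinsic volumes. -/
theorem isSteinerCoefficients_intrinsicVolume {n : ℕ} {K : Set (EuclideanSpace ℝ (Fin n))}
    (hK : IsCompact K) (hne : K.Nonempty) (hconv : Convex ℝ K) :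
    IsSteinerCoefficients K (intrinsicVolume K) := by
  obtain ⟨Q, hQ, hvol⟩ := exists_polynomial_volume_infDist_le hK hne hconv
  rw [finrank_euclideanSpace_fin] at hQ
  have h : IsSteinerCoefficients K fun i =>
      if n < i then 0 else Q.coeff (n - i) / unitBallVolume (n - i) := by
    refine ⟨fun j hj => if_pos hj, fun t ht => ?_⟩
    rw [hK.add_closedBall_zero ht, ← setOf_infDist_le_eq_cthickening hne ht, hvol t ht,
      Polynomial.eval_eq_sum_range' (Nat.lt_succ_of_le hQ)]
    refine Finset.sum_congr rfl fun j hj => ?_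
    have hj : j ≤ n := Finset.mem_range_succ_iff.1 hj
    dsimp only
    rw [if_neg (by omega), Nat.sub_sub_self hj, div_mul_cancel₀ _ (unitBallVolume_pos j).ne']
  convert h using 1
  exact funext h.intrinsicVolume_eq

/-! ### Gaussian integrals of distance functions by slicing. -/

section GaussianLayerCake

lemma hasDerivAt_neg_exp_neg_mul_sq (s r : ℝ) :
    HasDerivAt (fun r : ℝ => -Real.exp (-s * r ^ 2)) (2 * s * r * Real.exp (-s * r ^ 2)) r := by
  have h := (((hasDerivAt_pow 2 r).const_mul (-s)).exp).neg
  refine h.congr_deriv ?_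
  norm_num
  ring

lemma tendsto_neg_exp_neg_mul_sq {s : ℝ} (hs : 0 < s) :
    Tendsto (fun r : ℝ => -Real.exp (-s * r ^ 2)) atTop (𝓝 0) := by
  rw [← neg_zero]
  refine (Real.tendsto_exp_atBot.comp ?_).neg
  exact (tendsto_pow_atTop two_ne_zero).const_mul_atTop_of_neg (neg_lt_zero.2 hs)

lemma lintegral_Ioi_two_mul_exp_neg_mul_sq {s a : ℝ} (hs : 0 < s) (ha : 0 ≤ a) :
    ∫⁻ r in Set.Ioi a, ENNReal.ofReal (2 * s * r * Real.exp (-s * r ^ 2)) =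
      ENNReal.ofReal (Real.exp (-s * a ^ 2)) := by
  have hd : ∀ x ∈ Set.Ici a, HasDerivAt (fun r : ℝ => -Real.exp (-s * r ^ 2))
    (2 * s * x * Real.exp (-s * x ^ 2)) x := fun x _ => hasDerivAt_neg_exp_neg_mul_sq s x
  have hnn : ∀ x ∈ Set.Ioi a, 0 ≤ 2 * s * x * Real.exp (-s * x ^ 2) := fun x hx => by
    have : 0 < x := ha.trans_lt hx
    positivity
  rw [← ofReal_integral_eq_lintegral_ofReal
    (integrableOn_Ioi_deriv_of_nonneg' hd hnn (tendsto_neg_exp_neg_mul_sq hs))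
    ((ae_restrict_mem measurableSet_Ioi).mono hnn),
    integral_Ioi_of_hasDerivAt_of_nonneg' hd hnn (tendsto_neg_exp_neg_mul_sq hs), zero_sub,
    neg_neg]

/-- Write `exp(-s d²)` as the integral of `2 s r exp(-s r²)` over `r > d`, then apply Tonelli. -/
lemma lintegral_exp_neg_mul_sq_eq {α : Type*} [MeasurableSpace α] (μ : Measure α) [SFinite μ]
    {d : α → ℝ} (hd : Measurable d) (hd0 : ∀ x, 0 ≤ d x) {s : ℝ} (hs : 0 < s) :
    ∫⁻ x, ENNReal.ofReal (Real.exp (-s * d x ^ 2)) ∂μ =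
      ∫⁻ r in Set.Ioi (0 : ℝ), μ {x | d x ≤ r} *
        ENNReal.ofReal (2 * s * r * Real.exp (-s * r ^ 2)) := by
  set w : ℝ → ENNReal := fun r => ENNReal.ofReal (2 * s * r * Real.exp (-s * r ^ 2))
  have hw : Measurable w := by fun_prop
  have hm : MeasurableSet {z : α × ℝ | d z.1 ≤ z.2} :=
    measurableSet_le (hd.comp measurable_fst) measurable_snd
  have h1 : ∀ x, ENNReal.ofReal (Real.exp (-s * d x ^ 2)) =
      ∫⁻ r in Set.Ioi (0 : ℝ), {z : α × ℝ | d z.1 ≤ z.2}.indicator (fun z => w z.2) (x, r) := by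
    intro x
    rw [← lintegral_Ioi_two_mul_exp_neg_mul_sq hs (hd0 x), ← Measure.restrict_congr_set
      Ioi_ae_eq_Ici.symm]
    rw [← lintegral_indicator measurableSet_Ici, ← lintegral_indicator measurableSet_Ioi]
    refine lintegral_congr_ae ?_
    have h0 : ∀ᵐ r : ℝ, r ≠ 0 := by simp [ae_iff]
    filter_upwards [h0] with r hr0
    by_cases hr : d x ≤ r
    · have hr' : 0 < r := lt_of_le_of_ne ((hd0 x).trans hr) hr0.symm
      simp [Set.indicator, hr, hr', w]
    · simp [Set.indicator, hr]
  simp_rw [h1]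
  have hmeas : Measurable ({z : α × ℝ | d z.1 ≤ z.2}.indicator fun z => w z.2) :=
    (hw.comp measurable_snd).indicator hm
  rw [lintegral_lintegral_swap (f := fun x r => {z : α × ℝ | d z.1 ≤ z.2}.indicator
    (fun z => w z.2) (x, r)) hmeas.aemeasurable]
  refine setLIntegral_congr_fun measurableSet_Ioi fun r _ => ?_
  have : ∀ x, {z : α × ℝ | d z.1 ≤ z.2}.indicator (fun z => w z.2) (x, r) =
      {x | d x ≤ r}.indicator (fun _ => w r) x := fun x => by simp [Set.indicator]
  simp_rw [this]
  rw [lintegral_indicator_const (measurableSet_le hd measurable_const), mul_comm]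

/-- The moments `∫ r^j d(-exp(-s r²))` over the positive half line. -/
noncomputable def gaussianMoment (s : ℝ) (j : ℕ) : ℝ :=
  ∫ r in Set.Ioi (0 : ℝ), r ^ j * (2 * s * r * Real.exp (-s * r ^ 2))

lemma integrableOn_gaussianMoment {s : ℝ} (hs : 0 < s) (j : ℕ) :
    IntegrableOn (fun r : ℝ => r ^ j * (2 * s * r * Real.exp (-s * r ^ 2))) (Set.Ioi 0) := by
  have h := (integrableOn_rpow_mul_exp_neg_mul_sq hs (s := ((j + 1 : ℕ) : ℝ))
    (by have : (0 : ℝ) ≤ ((j + 1 : ℕ) : ℝ) := Nat.cast_nonneg _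
        linarith)).const_mul (2 * s)
  refine IntegrableOn.congr_fun h (fun r _ => ?_) measurableSet_Ioi
  rw [Real.rpow_natCast]
  ring

/-- Gaussian integral of a function whose sublevel sets have polynomial volume. -/
lemma integral_exp_neg_mul_sq_of_volume_le {α : Type*} [MeasurableSpace α] (μ : Measure α)
    [SFinite μ] {d : α → ℝ} (hd : Measurable d) (hd0 : ∀ x, 0 ≤ d x)
    (S : Finset ℕ) (c : ℕ → ℝ) (hfin : ∀ r, 0 < r → μ {x | d x ≤ r} ≠ ⊤)
    (hc : ∀ r, 0 < r → (μ {x | d x ≤ r}).toReal = ∑ j ∈ S, c j * r ^ j) {s : ℝ} (hs : 0 < s) :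
    Integrable (fun x => Real.exp (-s * d x ^ 2)) μ ∧
      ∫ x, Real.exp (-s * d x ^ 2) ∂μ = ∑ j ∈ S, c j * gaussianMoment s j := by
  have hint : IntegrableOn (fun r : ℝ => ∑ j ∈ S,
      c j * (r ^ j * (2 * s * r * Real.exp (-s * r ^ 2)))) (Set.Ioi 0) :=
    integrable_finsetSum _ fun j _ => (integrableOn_gaussianMoment hs j).const_mul (c j)
  have heq : ∀ r ∈ Set.Ioi (0 : ℝ), μ {x | d x ≤ r} *
      ENNReal.ofReal (2 * s * r * Real.exp (-s * r ^ 2)) =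
      ENNReal.ofReal (∑ j ∈ S, c j * (r ^ j * (2 * s * r * Real.exp (-s * r ^ 2)))) := by
    intro r hr
    have : ∑ j ∈ S, c j * (r ^ j * (2 * s * r * Real.exp (-s * r ^ 2))) =
        (μ {x | d x ≤ r}).toReal * (2 * s * r * Real.exp (-s * r ^ 2)) := by
      rw [hc r hr, Finset.sum_mul]
      exact Finset.sum_congr rfl fun j _ => by ring
    rw [this, ENNReal.ofReal_mul ENNReal.toReal_nonneg, ENNReal.ofReal_toReal (hfin r hr)]
  have hnn : ∀ r ∈ Set.Ioi (0 : ℝ),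
      0 ≤ ∑ j ∈ S, c j * (r ^ j * (2 * s * r * Real.exp (-s * r ^ 2))) := by
    intro r hr
    have : ∑ j ∈ S, c j * (r ^ j * (2 * s * r * Real.exp (-s * r ^ 2))) =
        (μ {x | d x ≤ r}).toReal * (2 * s * r * Real.exp (-s * r ^ 2)) := by
      rw [hc r hr, Finset.sum_mul]
      exact Finset.sum_congr rfl fun j _ => by ring
    rw [this]
    have : 0 < r := hr
    positivity
  have key : ∫⁻ x, ENNReal.ofReal (Real.exp (-s * d x ^ 2)) ∂μ =
      ENNReal.ofReal (∑ j ∈ S, c j * gaussianMoment s j) := by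
    rw [lintegral_exp_neg_mul_sq_eq μ hd hd0 hs, setLIntegral_congr_fun measurableSet_Ioi heq,
      ← ofReal_integral_eq_lintegral_ofReal hint ((ae_restrict_mem measurableSet_Ioi).mono hnn),
      integral_finsetSum _ fun j _ => (integrableOn_gaussianMoment hs j).const_mul (c j)]
    simp_rw [integral_const_mul]
    rfl
  have hmeas : AEStronglyMeasurable (fun x => Real.exp (-s * d x ^ 2)) μ :=
    (by fun_prop : Measurable fun x => Real.exp (-s * d x ^ 2)).aestronglyMeasurable
  have hpos : 0 ≤ᵐ[μ] fun x => Real.exp (-s * d x ^ 2) := ae_of_all _ fun x => (Real.exp_pos _).le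
  refine ⟨⟨hmeas, ?_⟩, ?_⟩
  · rw [hasFiniteIntegral_iff_ofReal hpos, key]
    exact ENNReal.ofReal_lt_top
  · rw [integral_eq_lintegral_of_nonneg_ae hpos hmeas, key, ENNReal.toReal_ofReal]
    have : ∑ j ∈ S, c j * gaussianMoment s j = ∫ r in Set.Ioi (0 : ℝ), ∑ j ∈ S,
        c j * (r ^ j * (2 * s * r * Real.exp (-s * r ^ 2))) := by
      rw [integral_finsetSum _ fun j _ => (integrableOn_gaussianMoment hs j).const_mul (c j)]
      simp_rw [integral_const_mul]
      rfl
    rw [this]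
    exact setIntegral_nonneg measurableSet_Ioi hnn

lemma toReal_volume_closedBall (j : ℕ) {r : ℝ} (hr : 0 ≤ r) :
    (volume (Metric.closedBall (0 : EuclideanSpace ℝ (Fin j)) r)).toReal =
      unitBallVolume j * r ^ j := by
  rw [unitBallVolume, Measure.addHaar_closedBall _ _ hr, Measure.addHaar_closedBall _ _ zero_le_one,
    finrank_euclideanSpace_fin, ENNReal.toReal_mul, ENNReal.toReal_ofReal (pow_nonneg hr _)]
  simp [mul_comm]

/-- Slicing the Gaussian integral on `ℝ^j` by balls evaluates the product at once, with no explicit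
ball volume or moment. -/
lemma unitBallVolume_mul_gaussianMoment {s : ℝ} (hs : 0 < s) (j : ℕ) :
    unitBallVolume j * gaussianMoment s j = (Real.pi / s) ^ ((j : ℝ) / 2) := by
  have hset : ∀ r : ℝ, {x : EuclideanSpace ℝ (Fin j) | ‖x‖ ≤ r} = Metric.closedBall 0 r :=
    fun r => by ext; simp
  have h := (integral_exp_neg_mul_sq_of_volume_le (volume : Measure (EuclideanSpace ℝ (Fin j)))
    (d := fun x => ‖x‖) measurable_norm (fun x => norm_nonneg x) {j} (fun _ => unitBallVolume j)
    (fun r _ => by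
      rw [hset]
      exact (isCompact_closedBall _ _).measure_lt_top.ne)
    (fun r hr => by
      rw [hset, toReal_volume_closedBall j hr.le, Finset.sum_singleton]) hs).2
  rw [Finset.sum_singleton, GaussianFourier.integral_rexp_neg_mul_sq_norm hs,
    finrank_euclideanSpace_fin] at h
  exact h.symm

end GaussianLayerCake

/-! ### The Wills functional: generating function, monotonicity and lower bounds. -/

section Wills

variable {n : ℕ} {K L : Set (EuclideanSpace ℝ (Fin n))}

lemma integrable_exp_neg_mul_infDist_sq (hK : IsCompact K) (hne : K.Nonempty) (hconv : Convex ℝ K)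
    {s : ℝ} (hs : 0 < s) :
    Integrable fun x => Real.exp (-s * Metric.infDist x K ^ 2) := by
  obtain ⟨Q, -, hvol⟩ := exists_polynomial_volume_infDist_le hK hne hconv
  exact (integral_exp_neg_mul_sq_of_volume_le volume
    (Metric.continuous_infDist_pt K).measurable (fun x => Metric.infDist_nonneg)
    (Finset.range (Q.natDegree + 1)) Q.coeff
    (fun r _ => (volume_setOf_infDist_le_lt_top hK hne r).ne)
    (fun r hr => by rw [hvol r hr.le, Polynomial.eval_eq_sum_range]) hs).1

lemma integral_exp_neg_mul_infDist_sq (hK : IsCompact K) (hne : K.Nonempty) (hconv : Convex ℝ K)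
    {s : ℝ} (hs : 0 < s) :
    ∫ x, Real.exp (-s * Metric.infDist x K ^ 2) =
      ∑ j ∈ Finset.range (n + 1), intrinsicVolume K (n - j) * (Real.pi / s) ^ ((j : ℝ) / 2) := by
  have hV := isSteinerCoefficients_intrinsicVolume hK hne hconv
  rw [(integral_exp_neg_mul_sq_of_volume_le volume
    (Metric.continuous_infDist_pt K).measurable (fun x => Metric.infDist_nonneg)
    (Finset.range (n + 1)) (fun j => intrinsicVolume K (n - j) * unitBallVolume j)
    (fun r _ => (volume_setOf_infDist_le_lt_top hK hne r).ne)
    (fun r hr => by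
      rw [setOf_infDist_le_eq_cthickening hne hr.le, ← hK.add_closedBall_zero hr.le,
        hV.2 r hr.le]) hs).2]
  simp_rw [mul_assoc, unitBallVolume_mul_gaussianMoment hs]

/-- The Wills functional of the dilate `e^t K`. -/
noncomputable def willsFunctional (t : ℝ) (K : Set (EuclideanSpace ℝ (Fin n))) : ℝ :=
  Real.exp (n * t) * ∫ x, Real.exp (-(Real.pi * Real.exp (2 * t)) * Metric.infDist x K ^ 2)

lemma pi_mul_exp_pos (t : ℝ) : 0 < Real.pi * Real.exp (2 * t) :=
  mul_pos Real.pi_pos (Real.exp_pos _)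

/-- This explains the weight `π e^{2t}`: after multiplication by `e^{nt}`, the coefficient of
`V_{n-j}` becomes `e^{(n-j)t}`. -/
lemma pi_div_pi_mul_exp_rpow (t : ℝ) (j : ℕ) :
    (Real.pi / (Real.pi * Real.exp (2 * t))) ^ ((j : ℝ) / 2) = Real.exp (-(j * t)) := by
  have : Real.pi / (Real.pi * Real.exp (2 * t)) = Real.exp (-(2 * t)) := by
    rw [Real.exp_neg]; field_simp
  rw [this, ← Real.exp_mul]
  congr 1
  ring

/-- The generating function of the intrinsic volumes is the Wills functional. -/
theorem sum_intrinsicVolume_mul_exp (hK : IsCompact K) (hne : K.Nonempty) (hconv : Convex ℝ K)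
    (t : ℝ) :
    ∑ j ∈ Finset.range (n + 1), intrinsicVolume K j * Real.exp (j * t) = willsFunctional t K := by
  rw [willsFunctional, integral_exp_neg_mul_infDist_sq hK hne hconv (pi_mul_exp_pos t),
    ← Finset.sum_range_reflect, Finset.mul_sum]
  refine Finset.sum_congr rfl fun j hj => ?_
  have hj : j ≤ n := Finset.mem_range_succ_iff.1 hj
  rw [pi_div_pi_mul_exp_rpow, mul_left_comm, ← Real.exp_add, Nat.add_sub_cancel, Nat.cast_sub hj]
  congr 2
  ring

lemma willsFunctional_mono (hK : IsCompact K) (hne : K.Nonempty) (hconv : Convex ℝ K)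
    (hL : IsCompact L) (hLconv : Convex ℝ L) (hKL : K ⊆ L) (t : ℝ) :
    willsFunctional t K ≤ willsFunctional t L := by
  refine mul_le_mul_of_nonneg_left (integral_mono
    (integrable_exp_neg_mul_infDist_sq hK hne hconv (pi_mul_exp_pos t))
    (integrable_exp_neg_mul_infDist_sq hL (hne.mono hKL) hLconv (pi_mul_exp_pos t)) fun x => ?_)
    (Real.exp_pos _).le
  refine Real.exp_le_exp.2 (mul_le_mul_of_nonpos_left ?_ (neg_nonpos.2 (pi_mul_exp_pos t).le))
  exact pow_le_pow_left₀ Metric.infDist_nonneg (Metric.infDist_le_infDist_of_subset hKL hne) 2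

/-- By monotonicity it suffices to treat a single point, whose functional is a normalized Gaussian
integral equal to `1`. -/
lemma one_le_willsFunctional (hK : IsCompact K) (hne : K.Nonempty) (hconv : Convex ℝ K) (t : ℝ) :
    1 ≤ willsFunctional t K := by
  obtain ⟨a, ha⟩ := hne
  refine le_trans (le_of_eq ?_) (willsFunctional_mono isCompact_singleton
    (Set.singleton_nonempty a) (convex_singleton a) hK hconv (Set.singleton_subset_iff.2 ha) t)
  simp_rw [willsFunctional, Metric.infDist_singleton, dist_eq_norm]
  rw [integral_sub_right_eq_self fun x : EuclideanSpace ℝ (Fin n) =>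
    Real.exp (-(Real.pi * Real.exp (2 * t)) * ‖x‖ ^ 2),
    GaussianFourier.integral_rexp_neg_mul_sq_norm (pi_mul_exp_pos t), finrank_euclideanSpace_fin,
    pi_div_pi_mul_exp_rpow, ← Real.exp_add, add_neg_cancel, Real.exp_zero]

/-- The integrand equals `1` on `K`. -/
lemma exp_mul_volume_le_willsFunctional (hK : IsCompact K) (hne : K.Nonempty) (hconv : Convex ℝ K)
    (t : ℝ) : Real.exp (n * t) * (volume K).toReal ≤ willsFunctional t K := by
  refine mul_le_mul_of_nonneg_left ?_ (Real.exp_pos _).le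
  have hint := integrable_exp_neg_mul_infDist_sq hK hne hconv (pi_mul_exp_pos t)
  refine le_trans (le_of_eq ?_) (setIntegral_le_integral (s := K) hint
    (ae_of_all _ fun x => (Real.exp_pos _).le))
  rw [setIntegral_congr_fun hK.measurableSet (g := fun _ => (1 : ℝ)) fun x hx => by
    simp [Metric.infDist_zero_of_mem hx]]
  simp [Measure.real]

end Wills

/-! ### Supermultiplicativity over orthogonal products. -/

section Product

variable {m n : ℕ}

/-- Splitting `ℝ^(m+n)` as `ℝ^m × ℝ^n`. -/
noncomputable def euclideanSplit (m n : ℕ) : EuclideanSpace ℝ (Fin (m + n)) ≃ᵐ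
    EuclideanSpace ℝ (Fin m) × EuclideanSpace ℝ (Fin n) :=
  (((MeasurableEquiv.toLp 2 (Fin (m + n) → ℝ)).symm.trans
    (MeasurableEquiv.piCongrLeft (fun _ => ℝ) finSumFinEquiv).symm).trans
    (MeasurableEquiv.sumPiEquivProdPi fun _ => ℝ)).trans
    ((MeasurableEquiv.toLp 2 (Fin m → ℝ)).prodCongr (MeasurableEquiv.toLp 2 (Fin n → ℝ)))

lemma measurePreserving_euclideanSplit : MeasurePreserving (euclideanSplit m n) :=
  (((EuclideanSpace.volume_preserving_symm_measurableEquiv_toLp (Fin (m + n))).trans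
    (volume_measurePreserving_piCongrLeft (fun _ => ℝ) finSumFinEquiv).symm).trans
    (volume_measurePreserving_sumPiEquivProdPi fun _ => ℝ)).trans
    ((EuclideanSpace.volume_preserving_symm_measurableEquiv_toLp (Fin m)).symm.prod
      (EuclideanSpace.volume_preserving_symm_measurableEquiv_toLp (Fin n)).symm)

lemma dist_sq_eq_euclideanSplit (x y : EuclideanSpace ℝ (Fin (m + n))) :
    dist x y ^ 2 = dist (euclideanSplit m n x).1 (euclideanSplit m n y).1 ^ 2 +
      dist (euclideanSplit m n x).2 (euclideanSplit m n y).2 ^ 2 := by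
  simp only [EuclideanSpace.dist_eq]
  rw [Real.sq_sqrt (by positivity), Real.sq_sqrt (by positivity), Real.sq_sqrt (by positivity),
    Fin.sum_univ_add]
  rfl

/-- The Wills functional is supermultiplicative. -/
lemma willsFunctional_mul_le {K : Set (EuclideanSpace ℝ (Fin m))}
    {L : Set (EuclideanSpace ℝ (Fin n))} {M : Set (EuclideanSpace ℝ (Fin (m + n)))}
    (hK : IsCompact K) (hKne : K.Nonempty) (hKc : Convex ℝ K)
    (hL : IsCompact L) (hLne : L.Nonempty) (hLc : Convex ℝ L)
    (hM : IsCompact M) (hMc : Convex ℝ M)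
    (hsub : ∀ z, (euclideanSplit m n z).1 ∈ K → (euclideanSplit m n z).2 ∈ L → z ∈ M) (t : ℝ) :
    willsFunctional t K * willsFunctional t L ≤ willsFunctional t M := by
  set s := Real.pi * Real.exp (2 * t)
  have hs : 0 < s := pi_mul_exp_pos t
  have hMne : M.Nonempty := by
    obtain ⟨a, ha⟩ := hKne
    obtain ⟨b, hb⟩ := hLne
    exact ⟨(euclideanSplit m n).symm (a, b), hsub _ (by simpa) (by simpa)⟩
  have hiK := integrable_exp_neg_mul_infDist_sq hK hKne hKc hs
  have hiL := integrable_exp_neg_mul_infDist_sq hL hLne hLc hs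
  have hiM := integrable_exp_neg_mul_infDist_sq hM hMne hMc hs
  have hprod := hiK.mul_prod hiL
  have h1 := (measurePreserving_euclideanSplit (m := m) (n := n)).integral_comp'
    (fun z => Real.exp (-s * Metric.infDist z.1 K ^ 2) * Real.exp (-s * Metric.infDist z.2 L ^ 2))
  have hprod' := (measurePreserving_euclideanSplit (m := m) (n := n)).integrable_comp_of_integrable
    hprod
  -- The nearest points in `K` and `L` combine to a point of `M`, so by Pythagoras `d(x,M)²` is at
  -- most the sum of the two squared distances.
  have h2 : ∀ x, Real.exp (-s * Metric.infDist (euclideanSplit m n x).1 K ^ 2) *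
      Real.exp (-s * Metric.infDist (euclideanSplit m n x).2 L ^ 2) ≤
      Real.exp (-s * Metric.infDist x M ^ 2) := by
    intro x
    obtain ⟨a, ha, hda⟩ := hK.exists_infDist_eq_dist hKne (euclideanSplit m n x).1
    obtain ⟨b, hb, hdb⟩ := hL.exists_infDist_eq_dist hLne (euclideanSplit m n x).2
    have hz : (euclideanSplit m n).symm (a, b) ∈ M := hsub _ (by simpa) (by simpa)
    have hd := dist_sq_eq_euclideanSplit x ((euclideanSplit m n).symm (a, b))
    rw [MeasurableEquiv.apply_symm_apply] at hd
    have hle := pow_le_pow_left₀ Metric.infDist_nonneg (Metric.infDist_le_dist_of_mem hz (x := x)) 2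
    rw [← Real.exp_add, hda, hdb]
    refine Real.exp_le_exp.2 ?_
    rw [hd] at hle
    nlinarith
  have h3 : (∫ x, Real.exp (-s * Metric.infDist x K ^ 2)) *
      ∫ y, Real.exp (-s * Metric.infDist y L ^ 2) ≤ ∫ z, Real.exp (-s * Metric.infDist z M ^ 2) := by
    rw [← integral_prod_mul, ← Measure.volume_eq_prod, ← h1]
    exact integral_mono hprod' hiM h2
  calc willsFunctional t K * willsFunctional t L
      = Real.exp (((m + n : ℕ) : ℝ) * t) * ((∫ x, Real.exp (-s * Metric.infDist x K ^ 2)) *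
          ∫ y, Real.exp (-s * Metric.infDist y L ^ 2)) := by
        rw [willsFunctional, willsFunctional, Nat.cast_add, add_mul, Real.exp_add]
        ring
    _ ≤ _ := mul_le_mul_of_nonneg_left h3 (Real.exp_pos _).le

end Product

/-! ### Exponential growth bound. -/

section UpperBound

lemma integrable_exp_neg_mul_abs {c : ℝ} (hc : 0 < c) :
    Integrable fun x : ℝ => Real.exp (-(c * |x|)) := by
  rw [← integrableOn_univ, ← Set.Iic_union_Ioi (a := (0 : ℝ))]
  refine IntegrableOn.union ?_ ?_
  · refine IntegrableOn.congr_fun (integrableOn_exp_mul_Iic hc 0) (fun x hx => ?_) measurableSet_Iic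
    rw [abs_of_nonpos hx, mul_neg, neg_neg]
  · refine IntegrableOn.congr_fun (exp_neg_integrableOn_Ioi 0 hc) (fun x hx => ?_) measurableSet_Ioi
    rw [abs_of_pos hx, neg_mul]

/-- Bodies contained in a cross-polytope of size linear in the dimension have Wills functionals
of at most exponential growth. -/
lemma exists_willsFunctional_le_pow (t C : ℝ) :
    ∃ B : ℝ, 0 < B ∧ ∀ (n : ℕ) (K : Set (EuclideanSpace ℝ (Fin n))), IsCompact K → K.Nonempty →
      Convex ℝ K → (∀ x ∈ K, ∑ i, |x i| ≤ n * C) → willsFunctional t K ≤ B ^ n := by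
  set s := Real.pi * Real.exp (2 * t)
  have hs : 0 < s := pi_mul_exp_pos t
  -- A product majorant of the integrand. For `y` nearest to `x`, `|x_i| - |y_i| ≤ |x_i - y_i| ≤ s
  -- |x_i - y_i|² + 1/(4s)` by completing the square; summing over `i` leaves `∑ |y_i| ≤ n C`.
  set g : ℝ → ℝ := fun u => Real.exp (C + 1 / (4 * s)) * Real.exp (-(1 * |u|))
  have hg : Integrable g := (integrable_exp_neg_mul_abs one_pos).const_mul _
  have hgpos : 0 < ∫ u, g u := by
    rw [integral_const_mul]
    exact mul_pos (Real.exp_pos _) (integral_exp_pos (integrable_exp_neg_mul_abs one_pos))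
  refine ⟨Real.exp t * ∫ u, g u, mul_pos (Real.exp_pos _) hgpos, fun n K hK hne hconv hsub => ?_⟩
  rw [willsFunctional, mul_pow, ← Real.exp_nat_mul]
  refine mul_le_mul_of_nonneg_left ?_ (Real.exp_pos _).le
  have hmp := EuclideanSpace.volume_preserving_symm_measurableEquiv_toLp (Fin n)
  have h1 := hmp.integral_comp' (fun z : Fin n → ℝ => ∏ i, g (z i))
  have hint : Integrable fun z : Fin n → ℝ => ∏ i, g (z i) := Integrable.fintype_prod fun _ => hg
  have hint' := hmp.integrable_comp_of_integrable hint
  have h2 := integral_fintype_prod_volume_eq_prod (fun (_ : Fin n) => g)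
  rw [Finset.prod_const, Finset.card_univ, Fintype.card_fin] at h2
  rw [← h2, ← h1]
  refine integral_mono (integrable_exp_neg_mul_infDist_sq hK hne hconv hs) hint' fun x => ?_
  obtain ⟨y, hy, hxy⟩ := hK.exists_infDist_eq_dist hne x
  have hy1 := hsub y hy
  change Real.exp (-s * Metric.infDist x K ^ 2) ≤ ∏ i, g (x i)
  simp only [g]
  simp_rw [← Real.exp_add]
  rw [← Real.exp_sum, hxy, EuclideanSpace.dist_eq, Real.sq_sqrt (by positivity)]
  refine Real.exp_le_exp.2 ?_
  have h3 : ∀ i, -s * dist (x i) (y i) ^ 2 ≤ 1 / (4 * s) - |x i| + |y i| := by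
    intro i
    have ha : |x i| - |y i| ≤ dist (x i) (y i) := abs_sub_abs_le_abs_sub _ _
    have hb : dist (x i) (y i) ≤ s * dist (x i) (y i) ^ 2 + 1 / (4 * s) := by
      rw [← sub_nonneg]
      have : s * dist (x i) (y i) ^ 2 + 1 / (4 * s) - dist (x i) (y i) =
          s * (dist (x i) (y i) - 1 / (2 * s)) ^ 2 := by field_simp; ring
      rw [this]
      positivity
    linarith
  calc -s * ∑ i, dist (x i) (y i) ^ 2 = ∑ i, -s * dist (x i) (y i) ^ 2 := Finset.mul_sum _ _ _
    _ ≤ ∑ i, (1 / (4 * s) - |x i| + |y i|) := Finset.sum_le_sum fun i _ => h3 i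
    _ = n * (1 / (4 * s)) - ∑ i, |x i| + ∑ i, |y i| := by
      rw [Finset.sum_add_distrib, Finset.sum_sub_distrib]; simp
    _ ≤ n * (1 / (4 * s)) - ∑ i, |x i| + n * C := by linarith
    _ = _ := by
      rw [Finset.sum_add_distrib]; simp; ring

end UpperBound

/-! ### Log-concave densities: regularity, decay and entropy. -/

section LogConcave

variable {p : ℝ → ℝ}

namespace IsLogConcave

lemma nonneg (hp : IsLogConcave p) (x : ℝ) : 0 ≤ p x := by
  obtain ⟨Φ, -, -, -, h⟩ := hp
  rw [h]
  exact ENNReal.toReal_nonneg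

lemma rpow_mul_rpow_le (hp : IsLogConcave p) (x y : ℝ) {a b : ℝ} (ha : 0 < a) (hb : 0 < b)
    (hab : a + b = 1) : p x ^ a * p y ^ b ≤ p (a * x + b * y) := by
  have hz := hp.nonneg (a * x + b * y)
  obtain ⟨Φ, hbot, -, hconv, h⟩ := hp
  have htop : ∀ x, Φ x = ⊤ → p x = 0 := fun x hx => by simp [h, hx]
  have hreal : ∀ x (u : ℝ), Φ x = u → p x = Real.exp (-u) := fun x u hx => by
    rw [h, hx, ← EReal.coe_neg, EReal.exp_coe, ENNReal.toReal_ofReal (Real.exp_pos _).le]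
  by_cases hx : Φ x = ⊤
  · rwa [htop x hx, Real.zero_rpow ha.ne', zero_mul]
  by_cases hy : Φ y = ⊤
  · rwa [htop y hy, Real.zero_rpow hb.ne', mul_zero]
  lift Φ x to ℝ using ⟨hx, hbot x⟩ with u hu
  lift Φ y to ℝ using ⟨hy, hbot y⟩ with v hv
  have hc := hconv x y a b ha hb hab
  rw [← hu, ← hv, ← EReal.coe_mul, ← EReal.coe_mul, ← EReal.coe_add] at hc
  have hz' : Φ (a * x + b * y) ≠ ⊤ := (hc.trans_lt (EReal.coe_lt_top _)).ne
  lift Φ (a * x + b * y) to ℝ using ⟨hz', hbot _⟩ with w hw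
  rw [hreal x u hu.symm, hreal y v hv.symm, hreal _ w hw.symm, ← Real.exp_mul, ← Real.exp_mul,
    ← Real.exp_add]
  have := EReal.coe_le_coe_iff.1 hc
  exact Real.exp_le_exp.2 (by linarith)

lemma upperSemicontinuous (hp : IsLogConcave p) : UpperSemicontinuous p := by
  obtain ⟨Φ, hbot, hlsc, -, h⟩ := hp
  have key : ∀ x c, 0 < c → (p x < c ↔ ((-Real.log c : ℝ) : EReal) < Φ x) := by
    intro x c hc
    by_cases hx : Φ x = ⊤
    · simpa [h, hx, hc] using EReal.coe_lt_top (-Real.log c)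
    · rw [h]
      lift Φ x to ℝ using ⟨hx, hbot x⟩ with u
      rw [← EReal.coe_neg, EReal.exp_coe, ENNReal.toReal_ofReal (Real.exp_pos _).le,
        EReal.coe_lt_coe_iff, ← Real.lt_log_iff_exp_lt hc, neg_lt]
  intro x c hc
  have hc0 : 0 < c := lt_of_le_of_lt (by rw [h]; exact ENNReal.toReal_nonneg) hc
  filter_upwards [hlsc x _ ((key x c hc0).1 hc)] with y hy
  exact (key y c hc0).2 hy

/-- Quasi-concavity, used to bound the length of superlevel sets by their mass. -/
lemma min_le (hp : IsLogConcave p) {x y z : ℝ} (hz : z ∈ Set.uIcc x y) :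
    min (p x) (p y) ≤ p z := by
  rw [← segment_eq_uIcc] at hz
  obtain ⟨a, b, ha, hb, hab, rfl⟩ := hz
  rcases ha.eq_or_lt with rfl | ha
  · obtain rfl : b = 1 := by linarith
    simp
  rcases hb.eq_or_lt with rfl | hb
  · obtain rfl : a = 1 := by linarith
    simp
  have hm : 0 ≤ min (p x) (p y) := le_min (hp.nonneg x) (hp.nonneg y)
  calc min (p x) (p y) = min (p x) (p y) ^ a * min (p x) (p y) ^ b := by
        rw [← Real.rpow_add' hm (by rw [hab]; exact one_ne_zero), hab, Real.rpow_one]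
    _ ≤ p x ^ a * p y ^ b := by
        exact mul_le_mul (Real.rpow_le_rpow hm (_root_.min_le_left _ _) ha.le)
          (Real.rpow_le_rpow hm (_root_.min_le_right _ _) hb.le) (Real.rpow_nonneg hm _)
          (Real.rpow_nonneg (hp.nonneg x) _)
    _ ≤ _ := hp.rpow_mul_rpow_le x y ha hb hab

lemma exists_pos (hp1 : ∫⁻ x, ENNReal.ofReal (p x) = 1) : ∃ x, 0 < p x := by
  by_contra! h
  simp [ENNReal.ofReal_of_nonpos (h _)] at hp1

/-- A log-concave density decays exponentially. -/
lemma exists_le_mul_exp_neg (hp : IsLogConcave p) (hp1 : ∫⁻ x, ENNReal.ofReal (p x) = 1) :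
    ∃ C κ : ℝ, 0 < C ∧ 0 < κ ∧ ∀ x, p x ≤ C * Real.exp (-(κ * |x|)) := by
  obtain ⟨x₀, h0⟩ := exists_pos hp1
  set δ := p x₀ * Real.exp (-1) with hδdef
  have hδ : 0 < δ := mul_pos h0 (Real.exp_pos _)
  have hδle : δ ≤ p x₀ := mul_le_of_le_one_right h0.le (Real.exp_le_one_iff.2 (by norm_num))
  -- The density is at least `δ` between `x₀` and `x`, and its total mass is `1`.
  have hlen : ∀ x, δ ≤ p x → |x - x₀| ≤ 1 / δ := by
    intro x hx
    have h1 : ENNReal.ofReal δ * volume (Set.uIcc x₀ x) ≤ 1 := by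
      rw [← hp1, ← setLIntegral_const]
      refine le_trans (setLIntegral_mono' measurableSet_uIcc fun z hz => ?_)
        (setLIntegral_le_lintegral _ _)
      exact ENNReal.ofReal_le_ofReal ((le_min hδle hx).trans (hp.min_le hz))
    rw [Real.volume_interval, ← ENNReal.ofReal_mul hδ.le, ENNReal.ofReal_le_one] at h1
    rw [le_div_iff₀ hδ]
    linarith
  -- Exceeding `1 / δ` forces the density below `p x₀ / e` at distance `R`; by concavity `log p`
  -- then drops at least at rate `1 / R` from `x₀` to any point farther out.
  set R := 1 / δ + 1
  have hR : 0 < R := by positivity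
  obtain ⟨x₁, -, hM⟩ := (hp.upperSemicontinuous.upperSemicontinuousOn
    (Metric.closedBall x₀ R)).exists_isMaxOn ⟨x₀, Metric.mem_closedBall_self hR.le⟩
    (isCompact_closedBall x₀ R)
  have hM0 : p x₀ ≤ p x₁ := hM (Metric.mem_closedBall_self hR.le)
  refine ⟨p x₁ * Real.exp ((|x₀| + R) / R), 1 / R, mul_pos (h0.trans_le hM0) (Real.exp_pos _),
    by positivity, fun x => ?_⟩
  rw [mul_assoc, ← Real.exp_add]
  have htri : |x| ≤ |x - x₀| + |x₀| := by
    simpa using abs_add_le (x - x₀) x₀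
  rcases le_or_gt |x - x₀| R with hx | hx
  · have h1 : p x ≤ p x₁ := hM (by rwa [Metric.mem_closedBall, Real.dist_eq])
    refine h1.trans (le_mul_of_one_le_right (h0.trans_le hM0).le (Real.one_le_exp ?_))
    rw [div_mul_eq_mul_div, one_mul, ← sub_eq_add_neg, ← sub_div]
    exact div_nonneg (by linarith) hR.le
  · have hx0 : 0 < |x - x₀| := hR.trans hx
    rcases (hp.nonneg x).eq_or_lt with hpx | hpx
    · rw [← hpx]
      have := h0.trans_le hM0
      positivity
    -- The weight that places the convex combination at distance exactly `R` from `x₀`.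
    set a := R / |x - x₀|
    have ha : 0 < a := by positivity
    have ha1 : 0 < 1 - a := sub_pos.2 ((div_lt_one hx0).2 hx)
    have hlt : p ((1 - a) * x₀ + a * x) < δ := by
      by_contra! hge
      have h1 := hlen _ hge
      have h2 : (1 - a) * x₀ + a * x - x₀ = a * (x - x₀) := by ring
      rw [h2, abs_mul, abs_of_pos ha, div_mul_cancel₀ _ hx0.ne'] at h1
      exact absurd h1 (by simp [R])
    have h1 := (hp.rpow_mul_rpow_le x₀ x ha1 ha (by ring)).trans_lt hlt
    have h2 := Real.log_lt_log (by positivity) h1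
    rw [Real.log_mul (by positivity) (by positivity), Real.log_rpow h0, Real.log_rpow hpx, hδdef,
      Real.log_mul h0.ne' (Real.exp_pos _).ne', Real.log_exp] at h2
    have h3 : Real.log (p x) ≤ Real.log (p x₀) - |x - x₀| / R := by
      have h4 : a * (Real.log (p x) - Real.log (p x₀)) < -1 := by linarith
      have h5 : |x - x₀| / R * a = 1 := by
        simp only [a]
        field_simp
      have h6 : 0 < |x - x₀| / R := by positivity
      nlinarith
    calc p x = Real.exp (Real.log (p x)) := (Real.exp_log hpx).symm
      _ ≤ Real.exp (Real.log (p x₀) - |x - x₀| / R) := Real.exp_le_exp.2 h3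
      _ = p x₀ * Real.exp (-(|x - x₀| / R)) := by
        rw [sub_eq_add_neg, Real.exp_add, Real.exp_log h0]
      _ ≤ p x₁ * Real.exp ((|x₀| + R) / R + -(1 / R * |x|)) := by
        refine mul_le_mul hM0 (Real.exp_le_exp.2 ?_) (Real.exp_pos _).le (h0.trans_le hM0).le
        rw [← sub_nonneg]
        have : (|x₀| + R) / R + -(1 / R * |x|) - -(|x - x₀| / R) =
          (|x₀| + R + |x - x₀| - |x|) / R := by ring
        rw [this]
        exact div_nonneg (by linarith) hR.le

lemma measurable (hp : IsLogConcave p) : Measurable p := hp.upperSemicontinuous.measurable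

end IsLogConcave

/-- Apply `log v ≤ v - 1` to `u` and to `1/√u`. Both majorants inherit exponential decay when `u = p
x`, so the entropy integral converges. -/
lemma abs_mul_log_le {u : ℝ} (hu : 0 ≤ u) : |u * Real.log u| ≤ 2 * √u + u ^ 2 := by
  rcases hu.eq_or_lt with rfl | hu
  · simp
  have h1 : Real.log u ≤ u - 1 := Real.log_le_sub_one_of_pos hu
  have hsq : 0 < √u := Real.sqrt_pos.2 hu
  have h2 : Real.log (√u)⁻¹ ≤ (√u)⁻¹ - 1 := Real.log_le_sub_one_of_pos (inv_pos.2 hsq)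
  rw [Real.log_inv, Real.log_sqrt hu.le] at h2
  have h3 : u * (√u)⁻¹ = √u := by
    rw [mul_inv_eq_iff_eq_mul₀ hsq.ne', Real.mul_self_sqrt hu.le]
  rw [abs_le]
  constructor
  · have := mul_le_mul_of_nonneg_left h2 hu.le
    nlinarith [sq_nonneg u]
  · have := mul_le_mul_of_nonneg_left h1 hu.le
    nlinarith

namespace IsLogConcave

lemma integrable (hp : IsLogConcave p) (hp1 : ∫⁻ x, ENNReal.ofReal (p x) = 1) :
    Integrable p := by
  refine ⟨hp.measurable.aestronglyMeasurable, ?_⟩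
  rw [hasFiniteIntegral_iff_ofReal (ae_of_all _ hp.nonneg), hp1]
  exact ENNReal.one_lt_top

lemma integral_eq_one (hp : IsLogConcave p) (hp1 : ∫⁻ x, ENNReal.ofReal (p x) = 1) :
    ∫ x, p x = 1 := by
  rw [integral_eq_lintegral_of_nonneg_ae (ae_of_all _ hp.nonneg)
    hp.measurable.aestronglyMeasurable, hp1, ENNReal.toReal_one]

lemma integrable_mul_log (hp : IsLogConcave p) (hp1 : ∫⁻ x, ENNReal.ofReal (p x) = 1) :
    Integrable fun x => p x * Real.log (p x) := by
  obtain ⟨C, κ, hC, hκ, hle⟩ := hp.exists_le_mul_exp_neg hp1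
  have hg : Integrable fun x : ℝ => 2 * (√C * Real.exp (-(κ / 2 * |x|))) +
      C ^ 2 * Real.exp (-(2 * κ * |x|)) :=
    (((integrable_exp_neg_mul_abs (half_pos hκ)).const_mul _).const_mul _).add
      ((integrable_exp_neg_mul_abs (by positivity)).const_mul _)
  refine hg.mono' (hp.measurable.mul hp.measurable.log).aestronglyMeasurable (ae_of_all _ fun x => ?_)
  refine (abs_mul_log_le (hp.nonneg x)).trans (add_le_add ?_ ?_)
  · refine mul_le_mul_of_nonneg_left ?_ zero_le_two
    have h1 := Real.sqrt_le_sqrt (hle x)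
    rw [Real.sqrt_mul hC.le, ← Real.exp_half] at h1
    refine h1.trans_eq ?_
    congr 2
    ring
  · refine (pow_le_pow_left₀ (hp.nonneg x) (hle x) 2).trans_eq ?_
    rw [mul_pow, ← Real.exp_nat_mul]
    congr 2
    push_cast
    ring

/-- The density exceeds `e^{-h}` on a set of positive volume. -/
lemma volume_exp_neg_entropy_le_pos (hp : IsLogConcave p)
    (hp1 : ∫⁻ x, ENNReal.ofReal (p x) = 1) :
    0 < volume {x | Real.exp (-differentialEntropy p) ≤ p x} := by
  rw [pos_iff_ne_zero]
  intro h0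
  set h := differentialEntropy p with hh
  have hlt : ∀ᵐ x, p x < Real.exp (-h) := by
    rw [ae_iff]
    simpa only [not_lt] using h0
  have hpos : ∀ x, p x < Real.exp (-h) → 0 < p x → 0 < -(p x * Real.log (p x)) - h * p x := by
    intro x hx hx0
    have h1 := Real.log_lt_log hx0 hx
    rw [Real.log_exp] at h1
    nlinarith
  -- By definition of `h` this function has integral `0`, yet it is positive wherever `0 < p <
  -- e^{-h}`. If `p < e^{-h}` almost everywhere, then `p` vanishes almost everywhere, contradicting
  -- mass `1`.
  have hint : Integrable fun x => -(p x * Real.log (p x)) - h * p x :=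
    (hp.integrable_mul_log hp1).neg.sub ((hp.integrable hp1).const_mul h)
  have hnn : 0 ≤ᵐ[volume] fun x => -(p x * Real.log (p x)) - h * p x := by
    filter_upwards [hlt] with x hx
    rcases (hp.nonneg x).eq_or_lt with hx0 | hx0
    · simp [← hx0]
    · exact (hpos x hx hx0).le
  have hzero : ∫ x, (-(p x * Real.log (p x)) - h * p x) = 0 := by
    rw [integral_sub (f := fun x => -(p x * Real.log (p x)))
      (hp.integrable_mul_log hp1).neg ((hp.integrable hp1).const_mul h),
      integral_neg, integral_const_mul, hp.integral_eq_one hp1, mul_one, hh, differentialEntropy,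
      sub_self]
  have hae := (integral_eq_zero_iff_of_nonneg_ae hnn hint).1 hzero
  have hp0 : p =ᵐ[volume] 0 := by
    filter_upwards [hlt, hae] with x hx hx0
    by_contra hne
    exact (hpos x hx (lt_of_le_of_ne (hp.nonneg x) (Ne.symm hne))).ne' hx0
  have := integral_congr_ae hp0
  rw [hp.integral_eq_one hp1] at this
  simp at this

end IsLogConcave

end LogConcave

/-! ### Typical sets as convex bodies, and the limit `Λ^ε`. -/

section TypicalSet

variable {p : ℝ → ℝ}

lemma mem_typicalSet {ε : ℝ} {n : ℕ} {x : EuclideanSpace ℝ (Fin n)} :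
    x ∈ typicalSet p ε n ↔ Real.exp (-(n * (differentialEntropy p + ε))) ≤ ∏ i, p (x i) := Iff.rfl

lemma typicalSet_mono {ε ε' : ℝ} (h : ε ≤ ε') (n : ℕ) : typicalSet p ε n ⊆ typicalSet p ε' n := by
  intro x hx
  refine le_trans (Real.exp_le_exp.2 ?_) hx
  have : (0 : ℝ) ≤ n := Nat.cast_nonneg n
  nlinarith

namespace IsLogConcave

lemma isClosed_typicalSet (hp : IsLogConcave p) (ε : ℝ) (n : ℕ) :
    IsClosed (typicalSet p ε n) := by
  rw [← isOpen_compl_iff, isOpen_iff_mem_nhds]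
  intro x hx
  rw [Set.mem_compl_iff, mem_typicalSet, not_le] at hx
  set c := Real.exp (-(n * (differentialEntropy p + ε)))
  -- A strict bound on the product leaves room `η > 0` in every factor, and upper semicontinuity
  -- keeps each factor within that room near `x`.
  have hcont : Tendsto (fun η : ℝ => ∏ i, (p (x i) + η)) (𝓝[>] 0) (𝓝 (∏ i, (p (x i) + 0))) :=
    ((by fun_prop : Continuous fun η : ℝ => ∏ i, (p (x i) + η)).tendsto 0).mono_left
      nhdsWithin_le_nhds
  simp only [add_zero] at hcont
  obtain ⟨η, hη, hη0⟩ := ((hcont.eventually_lt_const hx).and self_mem_nhdsWithin).exists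
  have hev : ∀ i, ∀ᶠ y : EuclideanSpace ℝ (Fin n) in 𝓝 x, p (y i) < p (x i) + η := fun i =>
    ((by fun_prop : Continuous fun y : EuclideanSpace ℝ (Fin n) => y i).tendsto x).eventually
      (hp.upperSemicontinuous (x i) _ (lt_add_of_pos_right _ hη0))
  filter_upwards [eventually_all.2 hev] with y hy
  rw [Set.mem_compl_iff, mem_typicalSet, not_le]
  exact (Finset.prod_le_prod (fun i _ => hp.nonneg _) fun i _ => (hy i).le).trans_lt hη

lemma convex_typicalSet (hp : IsLogConcave p) (ε : ℝ) (n : ℕ) : Convex ℝ (typicalSet p ε n) := by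
  refine convex_iff_forall_pos.2 fun x hx y hy a b ha hb hab => ?_
  rw [mem_typicalSet] at *
  set c := Real.exp (-(n * (differentialEntropy p + ε)))
  have hc : 0 < c := Real.exp_pos _
  calc c = c ^ a * c ^ b := by rw [← Real.rpow_add hc, hab, Real.rpow_one]
    _ ≤ (∏ i, p (x i)) ^ a * (∏ i, p (y i)) ^ b :=
      mul_le_mul (Real.rpow_le_rpow hc.le hx ha.le) (Real.rpow_le_rpow hc.le hy hb.le)
        (Real.rpow_nonneg hc.le _) (Real.rpow_nonneg (hc.le.trans hx) _)
    _ = ∏ i, (p (x i) ^ a * p (y i) ^ b) := by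
      rw [Finset.prod_mul_distrib, Real.finsetProd_rpow _ _ fun i _ => hp.nonneg _,
        Real.finsetProd_rpow _ _ fun i _ => hp.nonneg _]
    _ ≤ ∏ i, p ((a • x + b • y) i) := by
      refine Finset.prod_le_prod (fun i _ => mul_nonneg (Real.rpow_nonneg (hp.nonneg _) _)
        (Real.rpow_nonneg (hp.nonneg _) _)) fun i _ => ?_
      exact hp.rpow_mul_rpow_le (x i) (y i) ha hb hab

/-- Exponential decay of each factor turns the lower bound on the product into an `ℓ¹` bound with
`C` independent of `n`. -/
lemma exists_sum_abs_le_of_mem_typicalSet (hp : IsLogConcave p)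
    (hp1 : ∫⁻ x, ENNReal.ofReal (p x) = 1) (ε : ℝ) :
    ∃ C : ℝ, ∀ (n : ℕ), ∀ x ∈ typicalSet p ε n, ∑ i, |x i| ≤ n * C := by
  obtain ⟨C, κ, hC, hκ, hle⟩ := hp.exists_le_mul_exp_neg hp1
  refine ⟨(Real.log C + differentialEntropy p + ε) / κ, fun n x hx => ?_⟩
  have h1 : Real.exp (-(n * (differentialEntropy p + ε))) ≤
      Real.exp (n * Real.log C - κ * ∑ i, |x i|) := by
    calc _ ≤ ∏ i, p (x i) := hx
      _ ≤ ∏ i, C * Real.exp (-(κ * |x i|)) :=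
        Finset.prod_le_prod (fun i _ => hp.nonneg _) fun i _ => hle _
      _ = _ := by
        rw [Finset.prod_mul_distrib, Finset.prod_const, Finset.card_univ, Fintype.card_fin,
          ← Real.exp_sum, Finset.sum_neg_distrib, ← Finset.mul_sum, sub_eq_add_neg, Real.exp_add,
          Real.exp_nat_mul, Real.exp_log hC]
  rw [Real.exp_le_exp] at h1
  rw [mul_div_assoc', le_div_iff₀ hκ]
  linarith

lemma isCompact_typicalSet (hp : IsLogConcave p) (hp1 : ∫⁻ x, ENNReal.ofReal (p x) = 1)
    (ε : ℝ) (n : ℕ) : IsCompact (typicalSet p ε n) := by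
  obtain ⟨C, hC⟩ := hp.exists_sum_abs_le_of_mem_typicalSet hp1 ε
  refine Metric.isCompact_of_isClosed_isBounded (hp.isClosed_typicalSet ε n)
    (isBounded_iff_forall_norm_le.2 ⟨n * C, fun x hx => le_trans ?_ (hC n x hx)⟩)
  rw [EuclideanSpace.norm_eq]
  refine Real.sqrt_le_iff.2 ⟨Finset.sum_nonneg fun i _ => abs_nonneg _, ?_⟩
  simp_rw [Real.norm_eq_abs]
  exact Finset.sum_sq_le_sq_sum_of_nonneg fun i _ => abs_nonneg _

lemma nonempty_typicalSet (hp : IsLogConcave p) (hp1 : ∫⁻ x, ENNReal.ofReal (p x) = 1)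
    {ε : ℝ} (hε : 0 ≤ ε) (n : ℕ) : (typicalSet p ε n).Nonempty := by
  obtain ⟨a, ha⟩ := nonempty_of_measure_ne_zero (hp.volume_exp_neg_entropy_le_pos hp1).ne'
  refine ⟨WithLp.toLp 2 fun _ => a, typicalSet_mono hε n (mem_typicalSet.2 ?_)⟩
  simp only [Finset.prod_const, Finset.card_univ, Fintype.card_fin, add_zero]
  rw [← mul_neg, Real.exp_nat_mul]
  exact pow_le_pow_left₀ (Real.exp_pos _).le ha n

lemma volume_typicalSet_one_pos (hp : IsLogConcave p) (hp1 : ∫⁻ x, ENNReal.ofReal (p x) = 1) :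
    0 < (volume (typicalSet p 0 1)).toReal := by
  refine ENNReal.toReal_pos ?_ (hp.isCompact_typicalSet hp1 0 1).measure_lt_top.ne
  have hmp := (EuclideanSpace.volume_preserving_symm_measurableEquiv_toLp (Fin 1)).trans
    (volume_preserving_funUnique (Fin 1) ℝ)
  have hset : typicalSet p 0 1 = ((MeasurableEquiv.toLp 2 (Fin 1 → ℝ)).symm.trans
      (MeasurableEquiv.funUnique (Fin 1) ℝ)) ⁻¹' {x | Real.exp (-differentialEntropy p) ≤ p x} := by
    ext x
    rw [mem_typicalSet]
    simp
  rw [hset, hmp.measure_preimage_equiv]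
  exact (hp.volume_exp_neg_entropy_le_pos hp1).ne'

lemma mem_typicalSet_of_split (hp : IsLogConcave p) {ε : ℝ} {m n : ℕ}
    (z : EuclideanSpace ℝ (Fin (m + n))) (h1 : (euclideanSplit m n z).1 ∈ typicalSet p ε m)
    (h2 : (euclideanSplit m n z).2 ∈ typicalSet p ε n) : z ∈ typicalSet p ε (m + n) := by
  rw [mem_typicalSet] at *
  rw [Fin.prod_univ_add, Nat.cast_add, add_mul, neg_add, Real.exp_add]
  exact mul_le_mul h1 h2 (Real.exp_pos _).le (Finset.prod_nonneg fun i _ => hp.nonneg _)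

variable {ε : ℝ}

lemma logGenFun_eq (hp : IsLogConcave p) (hp1 : ∫⁻ x, ENNReal.ofReal (p x) = 1) (hε : 0 ≤ ε)
    (n : ℕ) (t : ℝ) : logGenFun p ε n t = Real.log (willsFunctional t (typicalSet p ε n)) := by
  rw [logGenFun, sum_intrinsicVolume_mul_exp (hp.isCompact_typicalSet hp1 ε n)
    (hp.nonempty_typicalSet hp1 hε n) (hp.convex_typicalSet ε n)]

lemma one_le_willsFunctional_typicalSet (hp : IsLogConcave p)
    (hp1 : ∫⁻ x, ENNReal.ofReal (p x) = 1) (hε : 0 ≤ ε) (n : ℕ) (t : ℝ) :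
    1 ≤ willsFunctional t (typicalSet p ε n) :=
  one_le_willsFunctional (hp.isCompact_typicalSet hp1 ε n) (hp.nonempty_typicalSet hp1 hε n)
    (hp.convex_typicalSet ε n) t

lemma logGenFun_nonneg (hp : IsLogConcave p) (hp1 : ∫⁻ x, ENNReal.ofReal (p x) = 1) (hε : 0 ≤ ε)
    (n : ℕ) (t : ℝ) : 0 ≤ logGenFun p ε n t := by
  rw [hp.logGenFun_eq hp1 hε]
  exact Real.log_nonneg (hp.one_le_willsFunctional_typicalSet hp1 hε n t)

lemma logGenFun_mono (hp : IsLogConcave p) (hp1 : ∫⁻ x, ENNReal.ofReal (p x) = 1) {ε' : ℝ}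
    (hε : 0 ≤ ε) (hεε' : ε ≤ ε') (n : ℕ) (t : ℝ) : logGenFun p ε n t ≤ logGenFun p ε' n t := by
  rw [hp.logGenFun_eq hp1 hε, hp.logGenFun_eq hp1 (hε.trans hεε')]
  refine Real.log_le_log
    (one_pos.trans_le (hp.one_le_willsFunctional_typicalSet hp1 hε n t)) ?_
  exact willsFunctional_mono (hp.isCompact_typicalSet hp1 ε n) (hp.nonempty_typicalSet hp1 hε n)
    (hp.convex_typicalSet ε n) (hp.isCompact_typicalSet hp1 ε' n) (hp.convex_typicalSet ε' n)
    (typicalSet_mono hεε' n) t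

/-- Comparing with `ε = 0` makes the constant independent of `ε`, as the limit `ε → 0+` requires. -/
lemma add_log_volume_le_logGenFun_one (hp : IsLogConcave p)
    (hp1 : ∫⁻ x, ENNReal.ofReal (p x) = 1) (hε : 0 ≤ ε) (t : ℝ) :
    t + Real.log (volume (typicalSet p 0 1)).toReal ≤ logGenFun p ε 1 t := by
  refine le_trans ?_ (hp.logGenFun_mono hp1 le_rfl hε 1 t)
  have hv := hp.volume_typicalSet_one_pos hp1
  rw [hp.logGenFun_eq hp1 le_rfl, ← Real.log_exp t, ← Real.log_mul (Real.exp_pos _).ne' hv.ne',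
    Real.log_exp]
  refine Real.log_le_log (mul_pos (Real.exp_pos _) hv) ?_
  have := exp_mul_volume_le_willsFunctional (hp.isCompact_typicalSet hp1 0 1)
    (hp.nonempty_typicalSet hp1 le_rfl 1) (hp.convex_typicalSet 0 1) t
  rwa [Nat.cast_one, one_mul] at this

lemma subadditive_neg_logGenFun (hp : IsLogConcave p) (hp1 : ∫⁻ x, ENNReal.ofReal (p x) = 1)
    (hε : 0 ≤ ε) (t : ℝ) : Subadditive fun n => -logGenFun p ε n t := by
  intro m n
  rw [← neg_add, neg_le_neg_iff, hp.logGenFun_eq hp1 hε, hp.logGenFun_eq hp1 hε,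
    hp.logGenFun_eq hp1 hε]
  have hm := one_pos.trans_le (hp.one_le_willsFunctional_typicalSet hp1 hε m t)
  have hn := one_pos.trans_le (hp.one_le_willsFunctional_typicalSet hp1 hε n t)
  rw [← Real.log_mul hm.ne' hn.ne']
  refine Real.log_le_log (mul_pos hm hn) ?_
  exact willsFunctional_mul_le (hp.isCompact_typicalSet hp1 ε m) (hp.nonempty_typicalSet hp1 hε m)
    (hp.convex_typicalSet ε m) (hp.isCompact_typicalSet hp1 ε n) (hp.nonempty_typicalSet hp1 hε n)
    (hp.convex_typicalSet ε n) (hp.isCompact_typicalSet hp1 ε _) (hp.convex_typicalSet ε _)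
    hp.mem_typicalSet_of_split t

lemma bddBelow_neg_logGenFun_div (hp : IsLogConcave p) (hp1 : ∫⁻ x, ENNReal.ofReal (p x) = 1)
    (hε : 0 ≤ ε) (t : ℝ) : BddBelow (Set.range fun n : ℕ => -logGenFun p ε n t / n) := by
  obtain ⟨C, hC⟩ := hp.exists_sum_abs_le_of_mem_typicalSet hp1 ε
  obtain ⟨B, hB, hle⟩ := exists_willsFunctional_le_pow t C
  -- The absolute value also covers `n = 0`, where division by zero gives the value `0`.
  refine ⟨-|Real.log B|, ?_⟩
  rintro _ ⟨n, rfl⟩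
  rcases n.eq_zero_or_pos with rfl | hn
  · simp
  have hn' : (0 : ℝ) < n := Nat.cast_pos.2 hn
  dsimp only
  rw [neg_div, neg_le_neg_iff, div_le_iff₀ hn', hp.logGenFun_eq hp1 hε]
  calc _ ≤ Real.log (B ^ n) := Real.log_le_log
        (one_pos.trans_le (hp.one_le_willsFunctional_typicalSet hp1 hε n t))
        (hle n _ (hp.isCompact_typicalSet hp1 ε n) (hp.nonempty_typicalSet hp1 hε n)
          (hp.convex_typicalSet ε n) (hC n))
    _ = Real.log B * n := by rw [Real.log_pow, mul_comm]
    _ ≤ _ := mul_le_mul_of_nonneg_right (le_abs_self _) hn'.le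

lemma tendsto_logGenFun_div_neg_lim (hp : IsLogConcave p)
    (hp1 : ∫⁻ x, ENNReal.ofReal (p x) = 1) (hε : 0 ≤ ε) (t : ℝ) :
    Tendsto (fun n : ℕ => logGenFun p ε n t / n) atTop
      (𝓝 (-(hp.subadditive_neg_logGenFun hp1 hε t).lim)) := by
  have := ((hp.subadditive_neg_logGenFun hp1 hε t).tendsto_lim
    (hp.bddBelow_neg_logGenFun_div hp1 hε t)).neg
  simpa only [neg_div, neg_neg] using this

lemma tendsto_limitLogGenFun (hp : IsLogConcave p) (hp1 : ∫⁻ x, ENNReal.ofReal (p x) = 1)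
    (hε : 0 ≤ ε) (t : ℝ) :
    Tendsto (fun n : ℕ => logGenFun p ε n t / n) atTop (𝓝 (limitLogGenFun p ε t)) :=
  tendsto_nhds_limUnder ⟨_, hp.tendsto_logGenFun_div_neg_lim hp1 hε t⟩

lemma limitLogGenFun_nonneg (hp : IsLogConcave p) (hp1 : ∫⁻ x, ENNReal.ofReal (p x) = 1)
    (hε : 0 ≤ ε) (t : ℝ) : 0 ≤ limitLogGenFun p ε t :=
  ge_of_tendsto' (hp.tendsto_limitLogGenFun hp1 hε t) fun n =>
    div_nonneg (hp.logGenFun_nonneg hp1 hε n t) (Nat.cast_nonneg n)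

lemma limitLogGenFun_mono (hp : IsLogConcave p) (hp1 : ∫⁻ x, ENNReal.ofReal (p x) = 1) {ε' : ℝ}
    (hε : 0 ≤ ε) (hεε' : ε ≤ ε') (t : ℝ) : limitLogGenFun p ε t ≤ limitLogGenFun p ε' t :=
  le_of_tendsto_of_tendsto' (hp.tendsto_limitLogGenFun hp1 hε t)
    (hp.tendsto_limitLogGenFun hp1 (hε.trans hεε') t) fun n =>
    div_le_div_of_nonneg_right (hp.logGenFun_mono hp1 hε hεε' n t) (Nat.cast_nonneg n)

/-- Fekete's limit dominates the term `n = 1`, so the one-dimensional bound suffices. -/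
lemma add_log_volume_le_limitLogGenFun (hp : IsLogConcave p)
    (hp1 : ∫⁻ x, ENNReal.ofReal (p x) = 1) (hε : 0 ≤ ε) (t : ℝ) :
    t + Real.log (volume (typicalSet p 0 1)).toReal ≤ limitLogGenFun p ε t := by
  rw [tendsto_nhds_unique (hp.tendsto_limitLogGenFun hp1 hε t)
    (hp.tendsto_logGenFun_div_neg_lim hp1 hε t)]
  have h := (hp.subadditive_neg_logGenFun hp1 hε t).lim_le_div
    (hp.bddBelow_neg_logGenFun_div hp1 hε t) one_ne_zero
  rw [Nat.cast_one, div_one] at h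
  linarith [hp.add_log_volume_le_logGenFun_one hp1 hε t]

end IsLogConcave

end TypicalSet

/-! ### Conjugates of a monotone family, and regularity of their limit. -/

section Conjugate

/-- A concave function on `[0,1]` is bounded below near each point by a Lipschitz minorant. -/
lemma ConcaveOn.exists_sub_mul_abs_le {g : ℝ → ℝ} (hg : ConcaveOn ℝ (Set.Icc 0 1) g) {x : ℝ}
    (hx : x ∈ Set.Icc (0 : ℝ) 1) :
    ∃ C, ∀ y ∈ Set.Icc (0 : ℝ) 1, g x - C * |y - x| ≤ g y := by
  -- The graph lies above the chord from `x` to the endpoint `e`.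
  have key : ∀ e ∈ Set.Icc (0 : ℝ) 1, ∀ y, ∀ s ∈ Set.Icc (0 : ℝ) 1, y - x = s * (e - x) →
      g x - |g x - g e| / |e - x| * |y - x| ≤ g y := by
    intro e he y s hs hy
    have h1 := hg.2 hx he (sub_nonneg.2 hs.2) hs.1 (by ring)
    simp only [smul_eq_mul] at h1
    have h2 : (1 - s) * x + s * e = y := by linarith
    rw [h2] at h1
    rcases eq_or_ne e x with rfl | hne
    · have : y = e := by simpa [sub_eq_zero] using hy
      simp [this]
    · have h3 : |g x - g e| / |e - x| * |y - x| = s * |g x - g e| := by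
        rw [hy, abs_mul, abs_of_nonneg hs.1]
        have := abs_pos.2 (sub_ne_zero.2 hne)
        field_simp
      rw [h3]
      nlinarith [le_abs_self (g x - g e), hs.1]
  refine ⟨|g x - g 0| / |0 - x| + |g x - g 1| / |1 - x|, fun y hy => ?_⟩
  have hA : 0 ≤ |g x - g 0| / |0 - x| * |y - x| := by positivity
  have hB : 0 ≤ |g x - g 1| / |1 - x| * |y - x| := by positivity
  rw [add_mul]
  rcases le_total y x with hyx | hyx
  · rcases hx.1.eq_or_lt with h0 | h0
    · have : y = x := le_antisymm hyx (h0 ▸ hy.1)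
      simp [this]
    · have := key 0 (by simp) y ((x - y) / x)
        ⟨div_nonneg (by linarith) h0.le, (div_le_one h0).2 (by linarith [hy.1])⟩
        (by field_simp; ring)
      linarith
  · rcases hx.2.eq_or_lt with h0 | h0
    · have : y = x := le_antisymm (h0 ▸ hy.2) hyx
      simp [this]
    · have h1 : 0 < 1 - x := by linarith
      have := key 1 (by simp) y ((y - x) / (1 - x))
        ⟨div_nonneg (by linarith) h1.le, (div_le_one h1).2 (by linarith [hy.2])⟩
        (by field_simp)
      linarith

variable {F : ℝ → ℝ → ℝ} {l : ℝ}

/-- For `t ≤ 0` use `f ≥ 0` and `θ ≥ 0`; for `t ≥ 0` use `f t ≥ t + l` and `θ ≤ 1`. -/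
lemma mul_sub_le_max {f : ℝ → ℝ} (h0 : ∀ t, 0 ≤ f t) (h1 : ∀ t, t + l ≤ f t) {θ : ℝ}
    (hθ : θ ∈ Set.Icc (0 : ℝ) 1) (t : ℝ) : θ * t - f t ≤ max 0 (-l) := by
  rcases le_total t 0 with ht | ht
  · refine le_max_of_le_left ?_
    nlinarith [h0 t, hθ.1]
  · refine le_max_of_le_right ?_
    nlinarith [h1 t, hθ.2]

lemma bddAbove_range_mul_sub {f : ℝ → ℝ} (h0 : ∀ t, 0 ≤ f t) (h1 : ∀ t, t + l ≤ f t) {θ : ℝ}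
    (hθ : θ ∈ Set.Icc (0 : ℝ) 1) : BddAbove (Set.range fun t => θ * t - f t) :=
  ⟨max 0 (-l), by rintro _ ⟨t, rfl⟩; exact mul_sub_le_max h0 h1 hθ t⟩

/-- Limits of conjugates along a monotone family of functions above `max 0 (t + l)`. -/
lemma tendsto_neg_convexConjugate (h0 : ∀ ε, 0 < ε → ∀ t, 0 ≤ F ε t)
    (h1 : ∀ ε, 0 < ε → ∀ t, t + l ≤ F ε t)
    (hmono : ∀ ε ε', 0 < ε → ε ≤ ε' → ∀ t, F ε t ≤ F ε' t) {θ : ℝ}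
    (hθ : θ ∈ Set.Icc (0 : ℝ) 1) :
    Tendsto (fun ε => -convexConjugate (F ε) θ) (𝓝[>] 0)
        (𝓝 (limUnder (𝓝[>] (0 : ℝ)) fun ε => -convexConjugate (F ε) θ)) ∧
      ∀ ε, 0 < ε → limUnder (𝓝[>] (0 : ℝ)) (fun ε => -convexConjugate (F ε) θ) ≤
        -convexConjugate (F ε) θ := by
  have hm : MonotoneOn (fun ε => -convexConjugate (F ε) θ) (Set.Ioi 0) := by
    intro ε hε ε' hε' hle
    exact neg_le_neg (ciSup_mono (bddAbove_range_mul_sub (h0 ε hε) (h1 ε hε) hθ) fun t =>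
      sub_le_sub_left (hmono ε ε' hε hle t) _)
  have hb : BddBelow ((fun ε => -convexConjugate (F ε) θ) '' Set.Ioi 0) := by
    refine ⟨-max 0 (-l), ?_⟩
    rintro _ ⟨ε, hε, rfl⟩
    exact neg_le_neg (ciSup_le fun t => mul_sub_le_max (h0 ε hε) (h1 ε hε) hθ t)
  have hlim := hm.tendsto_nhdsGT hb
  rw [hlim.limUnder_eq]
  exact ⟨hlim, fun ε hε => csInf_le hb ⟨ε, hε, rfl⟩⟩

lemma concaveOn_neg_convexConjugate {f : ℝ → ℝ} (h0 : ∀ t, 0 ≤ f t) (h1 : ∀ t, t + l ≤ f t) :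
    ConcaveOn ℝ (Set.Icc 0 1) fun θ => -convexConjugate f θ := by
  refine ⟨convex_Icc 0 1, fun x hx y hy a b ha hb hab => ?_⟩
  simp only [smul_eq_mul]
  have : convexConjugate f (a * x + b * y) ≤ a * convexConjugate f x + b * convexConjugate f y := by
    refine ciSup_le fun t => ?_
    have h2 : x * t - f t ≤ convexConjugate f x :=
      le_ciSup (bddAbove_range_mul_sub h0 h1 hx) t
    have h3 : y * t - f t ≤ convexConjugate f y :=
      le_ciSup (bddAbove_range_mul_sub h0 h1 hy) t
    calc (a * x + b * y) * t - f t = a * (x * t - f t) + b * (y * t - f t) := by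
          linear_combination (f t) * hab
      _ ≤ _ := add_le_add (mul_le_mul_of_nonneg_left h2 ha) (mul_le_mul_of_nonneg_left h3 hb)
  linarith

lemma concaveOn_limUnder_neg_convexConjugate (h0 : ∀ ε, 0 < ε → ∀ t, 0 ≤ F ε t)
    (h1 : ∀ ε, 0 < ε → ∀ t, t + l ≤ F ε t)
    (hmono : ∀ ε ε', 0 < ε → ε ≤ ε' → ∀ t, F ε t ≤ F ε' t) :
    ConcaveOn ℝ (Set.Icc 0 1)
      fun θ => limUnder (𝓝[>] (0 : ℝ)) fun ε => -convexConjugate (F ε) θ := by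
  refine ⟨convex_Icc 0 1, fun x hx y hy a b ha hb hab => ?_⟩
  have hz := convex_Icc (0 : ℝ) 1 hx hy ha hb hab
  refine le_of_tendsto_of_tendsto
    (((tendsto_neg_convexConjugate h0 h1 hmono hx).1.const_smul a).add
      ((tendsto_neg_convexConjugate h0 h1 hmono hy).1.const_smul b))
    (tendsto_neg_convexConjugate h0 h1 hmono hz).1 ?_
  filter_upwards [self_mem_nhdsWithin] with ε hε
  exact (concaveOn_neg_convexConjugate (h0 ε hε) (h1 ε hε)).2 hx hy ha hb hab

/-- Concavity gives lower semicontinuity, endpoints included. Upper semicontinuity needs the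
conjugate structure, since a concave function may jump down at an endpoint. -/
lemma continuousOn_limUnder_neg_convexConjugate (h0 : ∀ ε, 0 < ε → ∀ t, 0 ≤ F ε t)
    (h1 : ∀ ε, 0 < ε → ∀ t, t + l ≤ F ε t)
    (hmono : ∀ ε ε', 0 < ε → ε ≤ ε' → ∀ t, F ε t ≤ F ε' t) :
    ContinuousOn (fun θ => limUnder (𝓝[>] (0 : ℝ)) fun ε => -convexConjugate (F ε) θ)
      (Set.Icc 0 1) := by
  have hconc := concaveOn_limUnder_neg_convexConjugate h0 h1 hmono
  intro x hx
  refine tendsto_order.2 ⟨fun c hc => ?_, fun c hc => ?_⟩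
  · obtain ⟨C, hC⟩ := hconc.exists_sub_mul_abs_le hx
    have hlim : Tendsto (fun y => limUnder (𝓝[>] (0 : ℝ)) (fun ε => -convexConjugate (F ε) x) -
        C * |y - x|) (𝓝[Set.Icc 0 1] x) (𝓝 (limUnder (𝓝[>] (0 : ℝ))
          (fun ε => -convexConjugate (F ε) x) - C * |x - x|)) :=
      ((by fun_prop : Continuous fun y => limUnder (𝓝[>] (0 : ℝ))
        (fun ε => -convexConjugate (F ε) x) - C * |y - x|).tendsto x).mono_left nhdsWithin_le_nhds
    rw [sub_self, abs_zero, mul_zero, sub_zero] at hlim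
    filter_upwards [hlim.eventually_const_lt hc, self_mem_nhdsWithin] with y hy hy01
    exact hy.trans_le (hC y hy01)
  · obtain ⟨ε, hεc, hε⟩ := (((tendsto_neg_convexConjugate h0 h1 hmono hx).1.eventually_lt_const
      hc).and self_mem_nhdsWithin).exists
    -- For this fixed `ε` and `t`, the affine function `F ε t - y * t` lies above the limit on all
    -- of `[0,1]` and is below `c` at `x`.
    obtain ⟨t, ht⟩ := exists_lt_of_lt_ciSup (neg_lt.1 hεc)
    have hlim : Tendsto (fun y => F ε t - y * t) (𝓝[Set.Icc 0 1] x) (𝓝 (F ε t - x * t)) :=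
      ((by fun_prop : Continuous fun y => F ε t - y * t).tendsto x).mono_left nhdsWithin_le_nhds
    filter_upwards [hlim.eventually_lt_const (by linarith : F ε t - x * t < c),
      self_mem_nhdsWithin] with y hy hy01
    refine ((tendsto_neg_convexConjugate h0 h1 hmono hy01).2 ε hε).trans_lt (lt_of_le_of_lt ?_ hy)
    have := le_ciSup (bddAbove_range_mul_sub (h0 ε hε) (h1 ε hε) hy01) t
    rw [convexConjugate]
    linarith

end Conjugate

lemma lintegral_eq_one_of_map_eq_withDensity {Ω : Type*} [MeasurableSpace Ω] {P : Measure Ω}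
    [IsProbabilityMeasure P] {X : Ω → ℝ} (hX : Measurable X) {p : ℝ → ℝ}
    (hXp : P.map X = volume.withDensity (fun x => ENNReal.ofReal (p x))) :
    ∫⁻ x, ENNReal.ofReal (p x) = 1 := by
  have := Measure.isProbabilityMeasure_map (μ := P) hX.aemeasurable
  have h := measure_univ (μ := P.map X)
  rwa [hXp, withDensity_apply _ MeasurableSet.univ, Measure.restrict_univ] at h

theorem mainTheorem4 {Ω : Type*} [MeasurableSpace Ω] (P : Measure Ω) [IsProbabilityMeasure P]
    (X : Ω → ℝ) (hX : Measurable X) (p : ℝ → ℝ) (hp : IsLogConcave p)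
    (hXp : P.map X = volume.withDensity (fun x => ENNReal.ofReal (p x))) :
    -- the limits `Λ^ε(t)` exist and are finite
    (∀ ε : ℝ, 0 < ε → ∀ t : ℝ,
      Tendsto (fun n : ℕ => logGenFun p ε n t / n) atTop (𝓝 (limitLogGenFun p ε t))) ∧
    -- the conjugates `(Λ^ε)^*` are finite on `[0,1]`
    (∀ ε : ℝ, 0 < ε → ∀ θ ∈ Set.Icc (0 : ℝ) 1,
      BddAbove (Set.range fun t : ℝ => θ * t - limitLogGenFun p ε t)) ∧
    -- the pointwise limit `-Λ^*` exists on `[0,1]`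
    (∀ θ ∈ Set.Icc (0 : ℝ) 1,
      Tendsto (fun ε : ℝ => -convexConjugate (limitLogGenFun p ε) θ) (𝓝[>] 0)
        (𝓝 (candidateFun p θ))) ∧
    -- and it is continuous and concave there
    ContinuousOn (candidateFun p) (Set.Icc 0 1) ∧
    ConcaveOn ℝ (Set.Icc 0 1) (candidateFun p) := by
  have hp1 := lintegral_eq_one_of_map_eq_withDensity hX hXp
  have h0 : ∀ ε, 0 < ε → ∀ t, 0 ≤ limitLogGenFun p ε t := fun ε hε t =>
    hp.limitLogGenFun_nonneg hp1 hε.le t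
  have h1 : ∀ ε, 0 < ε → ∀ t, t + Real.log (volume (typicalSet p 0 1)).toReal ≤
      limitLogGenFun p ε t := fun ε hε t => hp.add_log_volume_le_limitLogGenFun hp1 hε.le t
  have hmono : ∀ ε ε', 0 < ε → ε ≤ ε' → ∀ t, limitLogGenFun p ε t ≤ limitLogGenFun p ε' t :=
    fun ε ε' hε hle t => hp.limitLogGenFun_mono hp1 hε.le hle t
  exact ⟨fun ε hε t => hp.tendsto_limitLogGenFun hp1 hε.le t,
    fun ε hε θ hθ => bddAbove_range_mul_sub (h0 ε hε) (h1 ε hε) hθ,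
    fun θ hθ => (tendsto_neg_convexConjugate h0 h1 hmono hθ).1,
    continuousOn_limUnder_neg_convexConjugate h0 h1 hmono,
    concaveOn_limUnder_neg_convexConjugate h0 h1 hmono⟩
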